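/- **Setting.** Let $U=[n]$ with $n\ge 1$, let $F_1,\dots,F_d:2^U\to\mathbb{R}_{\ge 0}$ be known monotone submodular functions, let $w\in\mathbb{R}^d_{\ge 0}$ be an unknown weight vector, and let $f(X)=\sum_{i=1}^d w_iF_i(X)$. Write $\Delta F(X,a)=\big(F_i(X\cup\{a\})-F_i(X)\big)_{i\le d}\in\mathbb{R}^d$. Let $\|w\|_2\le S$ with $S$ known, and $\|(F_1(\{a\}),\dots,F_d(\{a\}))\|_2\le L$ for all $a\in U$. A noisy query of the pair $(X,a)$, made as the $t$-th query, returns $\Delta F(X,a)^Tw+\xi_t$, where $\xi_1,\xi_2,\dots$ are i.i.d., centred and $R$-sub-Gaussian, i.e. $\mathbb{E}e^{s\xi_t}\le e^{s^2R^2/2}$ for all $s\in\mathbb{R}$. Fix a budget $\kappa\in\mathbb{N}$, $\epsilon>0$, $\delta\in(0,1)$ and $\lambda>0$, and let $OPT$ maximise $f$ over the sets of at most $\kappa$ elements. **Algorithm LG.** Start with the current solution set equal to $\emptyset$, $A=\lambda I$, $b=0$. For $l=1,\dots,\kappa$, let $S_l$ be the current set and proceed as follows. First query $(S_l,a)$ once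 for every $a\in[n]$. Each query of a pair $(X,a)$ with reward $r$ updates $A\gets A+\Delta F(X,a)\Delta F(X,a)^T$ and $b\gets b+r\,\Delta F(X,a)$; $T_{l',a}$ denotes the number of queries of $(S_{l'},a)$ made so far under the label $(l',a)$. Then repeat: put $\hat w=A^{-1}b$, $$C_t=R\sqrt{2\log\frac{\det(A)^{1/2}\det(\lambda I)^{-1/2}}{\delta}}+\lambda^{1/2}S,\qquad \beta_t(i,j)=C_t\,\|\Delta F(S_l,i)-\Delta F(S_l,j)\|_{A^{-1}},$$ where $\|x\|_{A^{-1}}=\sqrt{x^TA^{-1}x}$; choose $i_t\in\arg\max_i\Delta F(S_l,i)^T\hat w$, and let $j_t$ be a maximiser and $B(t)$ the maximum over $j$ of $\Delta F(S_l,j)^T\hat w-\Delta F(S_l,i_t)^T\hat w+\beta_t(j,i_t)$. If $B(t)\le\epsilon/\kappa$, add $i_t$ to the current set and end the round; otherwise query $(S_{l'},a)$ for a pair $(l',a)\in[l]\times[n]$ that minimises $T_{l',a}/p^*(l',a|l,i_t,j_t)$ among the pairs with $p^*(l',a|l,i_t,j_t)>0$. Here $$p^*(l',a|l,i,j)=\frac{|w^*_{l',a}(i,j)|}{\sum_{l''\in[l],a'\in[n]}|w^*_{l'',a'}(i,j)|},$$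 where $w^*(i,j)$ is an optimal solution (fixed at the start of the round) of $$\min_{(w_{l',a})}\ \sum_{l'\in[l],a\in[n]}|w_{l',a}|\quad\text{s.t.}\quad \Delta F(S_l,i)-\Delta F(S_l,j)=\sum_{l'\in[l],a\in[n]}w_{l',a}\,\Delta F(S_{l'},a),$$ and $\rho^l_{i,j}$ is the optimal value of this linear program; $p^*$ is taken as $0$ when $\rho^l_{i,j}=0$. Ties are broken by arbitrary fixed rules. After round $\kappa$ the current set is returned. **Theorem.** With probability at least $1-\delta$ the following statements hold. 1. LG terminates and returns a set $\hat S$ with $f(\hat S)\ge(1-e^{-1})f(OPT)-\epsilon$. 2. In every round the stopping condition $B(t)\le\epsilon/\kappa$ is met after finitely many samples. If moreover $\lambda\le\frac{2R^2}{S^2}\log\frac1\delta$ (i.e. $\lambda S^2\le 2R^2\log\frac1\delta$), then for every $l\in[\kappa]$ round $l$ takes at most $$\sum_{l'\in[l],a\in[n]}\max\Big\{4H^{(l)}_{l',a}R^2\Big(2\log\tfrac1\delta+d\log M^{(l)}\Big)+1-N^{(l)}_{l',a},\,0\Big\}$$ samples (the $n$ initial ones included), where $N^{(l)}_{l',a}$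 is the number of samples with label $(l',a)$ taken before round $l$, $N^{(l)}=\sum_{l'\in[l],a\in[n]}N^{(l)}_{l',a}$, $\Delta_{l,i}=\max_{a\in[n]}\Delta F(S_l,a)^Tw-\Delta F(S_l,i)^Tw$, $$H^{(l)}_{l',a}=\max_{i,j\in[n]}\frac{p^*(l',a|l,i,j)\,(\rho^l_{i,j})^2}{\max\big\{\frac{\epsilon}{\kappa},\frac{\max\{\Delta_{l,i},\Delta_{l,j}\}+\epsilon/\kappa}{3}\big\}^2},\qquad H^{(l)}_\epsilon=\sum_{l'\in[l],a\in[n]}H^{(l)}_{l',a},$$ $$M^{(l)}=\frac{16H^{(l)}_\epsilon R^2L^2}{\lambda}\log\frac1\delta+\frac{32(H^{(l)}_\epsilon)^2R^4L^4}{\lambda^2}+\frac{2(N^{(l)}+nl)L^2}{\lambda d}+2.$$ -/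

import Mathlib

open MeasureTheory ProbabilityTheory Matrix
open scoped NNReal

noncomputable section

/-! ### Set functions -/

/-- Submodularity of a set function on `Fin n`, in the form of diminishing returns. -/
def IsSubmodular {n : ℕ} (g : Finset (Fin n) → ℝ) : Prop :=
  ∀ X Y : Finset (Fin n), X ⊆ Y → ∀ x, x ∉ Y →
    g (insert x Y) - g Y ≤ g (insert x X) - g X

/-- The linear submodular objective `f(X) = ∑ i, w i * F i X`. -/
def objective {n d : ℕ} (F : Fin d → Finset (Fin n) → ℝ) (w : Fin d → ℝ)
    (X : Finset (Fin n)) : ℝ :=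
  ∑ i, w i * F i X

/-- The vector `ΔF(X, a)` of the marginal gains of adding `a` to `X`. -/
def marginal {n d : ℕ} (F : Fin d → Finset (Fin n) → ℝ) (X : Finset (Fin n)) (a : Fin n) :
    Fin d → ℝ :=
  fun i => F i (insert a X) - F i X

/-- The Euclidean norm of a vector. -/
def l2norm {d : ℕ} (v : Fin d → ℝ) : ℝ := √(∑ i, v i ^ 2)

/-- The matrix norm `‖x‖_A = √(xᵀ A x)`. -/
def matNorm {d : ℕ} (A : Matrix (Fin d) (Fin d) ℝ) (x : Fin d → ℝ) : ℝ :=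
  √(x ⬝ᵥ (A *ᵥ x))

/-- `c` is an optimal solution of the linear program: minimise
`∑ l' < l, ∑ a, |c l' a|` subject to `y = ∑ l' < l, ∑ a, c l' a • x l' a`. -/
def IsL1Optimal {n d : ℕ} (l : ℕ) (x : ℕ → Fin n → Fin d → ℝ) (y : Fin d → ℝ)
    (c : ℕ → Fin n → ℝ) : Prop :=
  y = ∑ l' ∈ Finset.range l, ∑ a, c l' a • x l' a ∧
  ∀ c' : ℕ → Fin n → ℝ, y = ∑ l' ∈ Finset.range l, ∑ a, c' l' a • x l' a →
    ∑ l' ∈ Finset.range l, ∑ a, |c l' a| ≤ ∑ l' ∈ Finset.range l, ∑ a, |c' l' a|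

/-- The points at which a real function on `Fin n` attains its maximum. -/
def argmaxSet {n : ℕ} (g : Fin n → ℝ) : Finset (Fin n) := by
  classical exact Finset.univ.filter fun i => ∀ j, g j ≤ g i

/-! ### The algorithm

Rounds are numbered from `0`: round `l` here is round `l + 1` in one-based counting. The solution
under construction is stored as the list of the elements added so far, in the order of
addition, so that the set `S_l` held at the beginning of round `l` consists of the first `l`
elements of the list. An arm is a pair `(l, a)`: it stands for the query of the marginal gain of
adding `a` to `S_l`. -/

/-- Everything that the algorithm is given or fixes in advance. -/
structure LGInput (n d : ℕ) where
  /-- cardinality budget -/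
  κ : ℕ
  /-- basis functions -/
  F : Fin d → Finset (Fin n) → ℝ
  /-- accuracy -/
  ε : ℝ
  /-- failure probability -/
  δ : ℝ
  /-- regulariser -/
  lam : ℝ
  /-- sub-Gaussian parameter of the noise -/
  R : ℝ≥0
  /-- known upper bound for the Euclidean norm of the weight vector -/
  W : ℝ
  /-- the linear program solver: `wstar p i j l' a` is the weight of arm `(l', a)` for the
  direction `(i, j)` when `p` is the list of the elements added so far -/
  wstar : List (Fin n) → Fin n → Fin n → ℕ → Fin n → ℝ
  /-- tie-breaking rule for the choice of `i_t`, which may depend on the arms sampled so far -/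
  tieI : List (ℕ × Fin n) → Finset (Fin n) → Fin n
  /-- tie-breaking rule for the choice of `j_t` -/
  tieJ : List (ℕ × Fin n) → Finset (Fin n) → Fin n
  /-- tie-breaking rule for the choice of the next arm -/
  tieArm : List (ℕ × Fin n) → Finset (ℕ × Fin n) → ℕ × Fin n

namespace LGInput

variable {n d : ℕ} (I : LGInput n d)

/-- The feature vector `ΔF(S_{l'}, a)`, `p` being the list of the elements added so far. -/
def feature (p : List (Fin n)) (l' : ℕ) (a : Fin n) : Fin d → ℝ :=
  marginal I.F (p.take l').toFinset a

/-- The direction `ΔF(S, i) - ΔF(S, j)` for the current set `S`. -/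
def direction (p : List (Fin n)) (i j : Fin n) : Fin d → ℝ :=
  marginal I.F p.toFinset i - marginal I.F p.toFinset j

/-- The value of the linear program at the solution in use, over the arms of the past rounds and
of the current one. -/
def rho (p : List (Fin n)) (i j : Fin n) : ℝ :=
  ∑ l' ∈ Finset.range (p.length + 1), ∑ a, |I.wstar p i j l' a|

/-- The allocation ratio `p*(l', a | l, i, j)`. -/
def pstar (p : List (Fin n)) (i j : Fin n) (l' : ℕ) (a : Fin n) : ℝ :=
  |I.wstar p i j l' a| / I.rho p i j

/-- The solver returns optimal solutions, and the tie-breaking rules choose from the sets that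
they are given. -/
def IsAdmissible : Prop :=
  (∀ p i j, IsL1Optimal (p.length + 1) (I.feature p) (I.direction p i j) (I.wstar p i j)) ∧
  (∀ h Q, Q.Nonempty → I.tieI h Q ∈ Q) ∧
  (∀ h Q, Q.Nonempty → I.tieJ h Q ∈ Q) ∧
  (∀ h Q, Q.Nonempty → I.tieArm h Q ∈ Q)

end LGInput

/-- The memory of the algorithm. -/
structure LGState (n d : ℕ) where
  /-- the elements added so far, in order; their number is the index of the current round -/
  picks : List (Fin n)
  /-- how many of the `n` initial samples of the current round have been taken -/
  swept : ℕ
  /-- the arms sampled so far, most recent first -/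
  pulls : List (ℕ × Fin n)
  /-- the regularised design matrix -/
  A : Matrix (Fin d) (Fin d) ℝ
  /-- the reward-weighted sum of the sampled feature vectors -/
  b : Fin d → ℝ

namespace LGState

variable {n d : ℕ} (I : LGInput n d) (w : Fin d → ℝ) (noise : ℕ → ℝ) (s : LGState n d)

/-- The solution set under construction. -/
def sol : Finset (Fin n) := s.picks.toFinset

/-- The number of samples taken so far from the arm `(l', a)`. -/
def T (l' : ℕ) (a : Fin n) : ℕ := s.pulls.count (l', a)

/-- The regularised least-squares estimate of the weight vector. -/
def what : Fin d → ℝ := s.A⁻¹ *ᵥ s.b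

/-- The confidence parameter `C_t`. -/
def C : ℝ :=
  I.R * √(2 * Real.log
    (s.A.det ^ (1 / 2 : ℝ) * (I.lam • (1 : Matrix (Fin d) (Fin d) ℝ)).det ^ (-(1 / 2) : ℝ) / I.δ))
  + I.lam ^ (1 / 2 : ℝ) * I.W

/-- The confidence width `β_t(i, j)`. -/
def beta (i j : Fin n) : ℝ :=
  s.C I * matNorm s.A⁻¹ (I.direction s.picks i j)

/-- The element of the largest estimated marginal gain. -/
def iSel : Fin n :=
  I.tieI s.pulls (argmaxSet fun i => marginal I.F s.sol i ⬝ᵥ s.what)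

/-- The upper confidence bound for the advantage of `j` over the element `i_t`. -/
def ucb (j : Fin n) : ℝ :=
  marginal I.F s.sol j ⬝ᵥ s.what - marginal I.F s.sol (s.iSel I) ⬝ᵥ s.what
    + s.beta I j (s.iSel I)

/-- The element of the largest upper confidence bound. -/
def jSel : Fin n := I.tieJ s.pulls (argmaxSet (s.ucb I))

/-- The quantity `B(t)` of the stopping condition. -/
def B : ℝ := s.ucb I (s.jSel I)

/-- The arms `(l', a)` of positive allocation ratio that minimise `T / p*`. -/
def armSet : Finset (ℕ × Fin n) := by
  classical exact
    let p : ℕ × Fin n → ℝ := fun q => I.pstar s.picks (s.iSel I) (s.jSel I) q.1 q.2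
    let supp := (Finset.range (s.picks.length + 1) ×ˢ (Finset.univ : Finset (Fin n))).filter
      fun q => 0 < p q
    supp.filter fun q => ∀ q' ∈ supp, (s.T q.1 q.2 : ℝ) / p q ≤ (s.T q'.1 q'.2 : ℝ) / p q'

/-- The arm to be sampled next. -/
def armSel : ℕ × Fin n := I.tieArm s.pulls (s.armSet I)

/-- Take one sample of the arm `q` and update the memory. The reward is
`ΔF(S_{l'}, a)ᵀ w + ξ_t`, where `t` is the number of samples taken before. -/
def sample (q : ℕ × Fin n) : LGState n d :=
  let x := I.feature s.picks q.1 q.2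
  { s with
    pulls := q :: s.pulls
    A := s.A + vecMulVec x x
    b := s.b + (x ⬝ᵥ w + noise s.pulls.length) • x }

/-- Add `i_t` to the solution and begin the next round. -/
def nextRound : LGState n d :=
  { s with
    picks := s.picks ++ [s.iSel I]
    swept := 0 }

/-- The algorithm has returned. -/
def Halted : Prop := s.picks.length = I.κ

/-- The stopping condition of a round: the initial samples have been taken, and
`B(t) ≤ ε / κ`. -/
def Stops : Prop := s.swept = n ∧ s.B I ≤ I.ε / I.κ

open Classical in
/-- One step of the algorithm. -/
def step : LGState n d :=
  if s.Halted I then s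
  else if h : s.swept < n then
    { s.sample I w noise (s.picks.length, ⟨s.swept, h⟩) with swept := s.swept + 1 }
  else if s.B I ≤ I.ε / I.κ then s.nextRound I
  else s.sample I w noise (s.armSel I)

/-- The memory at the start. -/
def start : LGState n d :=
  { picks := []
    swept := 0
    pulls := []
    A := I.lam • (1 : Matrix (Fin d) (Fin d) ℝ)
    b := 0 }

/-- The memory after `k` steps, when the true weight vector is `w` and the noise of the samples
is the sequence `noise`. -/
def run (k : ℕ) : LGState n d := (step I w noise)^[k] (start I)

/-! ### The quantities of the sample bound

They are evaluated at the memory `s` at the beginning of a round, when no sample of this round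
has been taken. In particular `s.T l' a` is then the number of samples of the arm `(l', a)` taken
in earlier rounds, and the one-based index of the round is `s.picks.length + 1`. -/

/-- The gap between the best marginal gain and that of `i`. -/
def gap (i : Fin n) : ℝ :=
  (⨆ a : Fin n, marginal I.F s.sol a ⬝ᵥ w) - marginal I.F s.sol i ⬝ᵥ w

/-- The complexity `H_{l', a}` of an arm. -/
def H (l' : ℕ) (a : Fin n) : ℝ :=
  ⨆ q : Fin n × Fin n,
    I.pstar s.picks q.1 q.2 l' a * I.rho s.picks q.1 q.2 ^ 2 /
      (max (I.ε / I.κ) ((max (s.gap I w q.1) (s.gap I w q.2) + I.ε / I.κ) / 3)) ^ 2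

/-- The total complexity `H_ε` of the round. -/
def Htot : ℝ := ∑ l' ∈ Finset.range (s.picks.length + 1), ∑ a, s.H I w l' a

/-- The number of samples taken before the round. -/
def Ntot : ℕ := ∑ l' ∈ Finset.range (s.picks.length + 1), ∑ a, s.T l' a

/-- The argument `M` of the logarithm in the sample bound; `L` is a bound for the features. -/
def M (L : ℝ) : ℝ :=
  16 * s.Htot I w * I.R ^ 2 * L ^ 2 / I.lam * Real.log (1 / I.δ)
    + 32 * s.Htot I w ^ 2 * I.R ^ 4 * L ^ 4 / I.lam ^ 2
    + 2 * ((s.Ntot : ℝ) + n * ((s.picks.length : ℝ) + 1)) * L ^ 2 / (I.lam * d) + 2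

/-- The bound for the number of samples taken in the round. -/
def sampleBound (L : ℝ) : ℝ :=
  ∑ l' ∈ Finset.range (s.picks.length + 1), ∑ a : Fin n,
    max (4 * s.H I w l' a * I.R ^ 2 * (2 * Real.log (1 / I.δ) + d * Real.log (s.M I w L))
      + 1 - s.T l' a) 0

end LGState

end

/-! ### Linear algebra -/

section LinearAlgebra

variable {d : ℕ}

/-! Let `v` be the noise-weighted sum of the sampled features. For `R ≠ 0` the potential `√(λ^d /
det A) · exp(vᵀA⁻¹v / (2R²))` starts at one and does not grow in expectation. By the determinant
lemma and Sherman-Morrison, a sample of feature `x` changes it only through `xᵀA⁻¹x`, `xᵀA⁻¹v` and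
the new noise value, so this reduces to a scalar exponential moment (`lintegral_exp_quadratic_le`).
Ville's inequality keeps the potential below `1/δ` at all steps with probability at least `1 - δ`.
Taking logarithms and adding the bias of the regulariser puts `w` in every confidence ellipsoid
(`le_measureReal_forall_confident`). On this event the rest is deterministic.

Value: when a round stops, `i_t` is within `ε/κ` of the best marginal gain. The greedy argument for
submodular functions then contracts the distance to the optimum by `1 - 1/κ`, up to `ε/κ`
(`sub_objective_nextRound_le`), and `(1 - 1/κ)^κ ≤ e⁻¹`.

Samples: while a round goes on, the width `β_t` exceeds the threshold in the denominator of `H`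
(`Confident.lt_beta`). Expanding the direction by the linear program, Cauchy-Schwarz and the rule
that minimises `T/p*` give `T ‖y‖² ≤ p* ρ²` for the arm about to be sampled
(`WellFormed.T_armSel_mul_le`), hence `T ≤ C_t² H`. But `C_t` grows with the number of samples.
`exists_stops` breaks the circle by induction along the round, given some `G` with `C_t² ≤ G` as
long as the sample count is at most what `G` itself allows. `C_sq_le_of_length_le` shows that the
`G` of the stated bound qualifies if `λS²` is small; `exists_bound` finds some `G` without that
condition, which suffices for termination. -/

lemma dotProduct_mulVec_comm_of_isHermitian {A : Matrix (Fin d) (Fin d) ℝ} (hA : A.IsHermitian)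
    (x y : Fin d → ℝ) : x ⬝ᵥ (A *ᵥ y) = y ⬝ᵥ (A *ᵥ x) := by
  have h : Aᵀ = A := by simpa [Matrix.IsHermitian, conjTranspose_eq_transpose_of_trivial] using hA
  rw [dotProduct_mulVec, ← mulVec_transpose, h, dotProduct_comm]

lemma dotProduct_mulVec_nonneg {A : Matrix (Fin d) (Fin d) ℝ} (hA : A.PosSemidef)
    (x : Fin d → ℝ) : 0 ≤ x ⬝ᵥ (A *ᵥ x) := by
  simpa using hA.dotProduct_mulVec_nonneg x

/-- Cauchy-Schwarz for a semidefinite form: the form is nonnegative at `x + t • y` for all real `t`,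
so this quadratic in `t` has nonpositive discriminant. -/
lemma sq_dotProduct_mulVec_le {A : Matrix (Fin d) (Fin d) ℝ} (hA : A.PosSemidef)
    (x y : Fin d → ℝ) :
    (x ⬝ᵥ (A *ᵥ y)) ^ 2 ≤ (x ⬝ᵥ (A *ᵥ x)) * (y ⬝ᵥ (A *ᵥ y)) := by
  have key : ∀ t : ℝ, 0 ≤ (y ⬝ᵥ (A *ᵥ y)) * (t * t) + 2 * (x ⬝ᵥ (A *ᵥ y)) * t
      + x ⬝ᵥ (A *ᵥ x) := by
    intro t
    have h := dotProduct_mulVec_nonneg hA (x + t • y)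
    have h2 := dotProduct_mulVec_comm_of_isHermitian hA.isHermitian y x
    simp only [mulVec_add, mulVec_smul, add_dotProduct, dotProduct_add, smul_dotProduct,
      dotProduct_smul, smul_eq_mul, h2] at h
    linarith
  have := discrim_le_zero key
  rw [discrim] at this
  nlinarith

lemma abs_dotProduct_mulVec_le {A : Matrix (Fin d) (Fin d) ℝ} (hA : A.PosSemidef)
    (x y : Fin d → ℝ) : |x ⬝ᵥ (A *ᵥ y)| ≤ matNorm A x * matNorm A y := by
  rw [matNorm, matNorm, ← Real.sqrt_mul (dotProduct_mulVec_nonneg hA x)]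
  exact Real.abs_le_sqrt (sq_dotProduct_mulVec_le hA x y)

lemma matNorm_neg (A : Matrix (Fin d) (Fin d) ℝ) (x : Fin d → ℝ) :
    matNorm A (-x) = matNorm A x := by
  simp [matNorm, mulVec_neg]

lemma matNorm_nonneg (A : Matrix (Fin d) (Fin d) ℝ) (x : Fin d → ℝ) : 0 ≤ matNorm A x :=
  Real.sqrt_nonneg _

lemma mulVec_inv_cancel {A : Matrix (Fin d) (Fin d) ℝ} (hA : A.PosDef) (x : Fin d → ℝ) :
    A *ᵥ (A⁻¹ *ᵥ x) = x := by
  rw [mulVec_mulVec, mul_nonsing_inv _ (isUnit_iff_ne_zero.mpr hA.det_pos.ne'), one_mulVec]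

lemma inv_mulVec_cancel {A : Matrix (Fin d) (Fin d) ℝ} (hA : A.PosDef) (x : Fin d → ℝ) :
    A⁻¹ *ᵥ (A *ᵥ x) = x := by
  rw [mulVec_mulVec, nonsing_inv_mul _ (isUnit_iff_ne_zero.mpr hA.det_pos.ne'), one_mulVec]

/-- If `A` dominates `lam • 1`, then `A⁻¹` is dominated by `lam⁻¹ • 1`. -/
lemma dotProduct_inv_mulVec_le {A : Matrix (Fin d) (Fin d) ℝ} (hA : A.PosDef) {lam : ℝ}
    (hlam : 0 < lam) (h : ∀ z, lam * (z ⬝ᵥ z) ≤ z ⬝ᵥ (A *ᵥ z)) (w : Fin d → ℝ) :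
    lam * (w ⬝ᵥ (A⁻¹ *ᵥ w)) ≤ w ⬝ᵥ w := by
  set z := A⁻¹ *ᵥ w with hz
  have hAz : A *ᵥ z = w := mulVec_inv_cancel hA w
  have h1 := h z
  rw [hAz, dotProduct_comm z w] at h1
  -- Expanding this square and inserting `lam² z·z ≤ lam w·z`, which is `lam` times `h1`, leaves the
  -- claim.
  have h2 : 0 ≤ (w - lam • z) ⬝ᵥ (w - lam • z) := by
    simpa using dotProduct_star_self_nonneg (w - lam • z)
  simp only [sub_dotProduct, dotProduct_sub, smul_dotProduct, dotProduct_smul, smul_eq_mul,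
    dotProduct_comm z w] at h2
  nlinarith

/-- The squared norm of a combination of vectors `x q` in the norm of `A⁻¹`, when `A` dominates
the weighted sum of the `x q (x q)ᵀ`. -/
lemma dotProduct_inv_mulVec_sum_le {ι : Type*} {A : Matrix (Fin d) (Fin d) ℝ} (hA : A.PosDef)
    (s : Finset ι) (x : ι → Fin d → ℝ) (T : ι → ℝ)
    (hT : ∀ z, ∑ q ∈ s, T q * (x q ⬝ᵥ z) ^ 2 ≤ z ⬝ᵥ (A *ᵥ z))
    (c : ι → ℝ) (hc : ∀ q ∈ s, c q ≠ 0 → 0 < T q) (hT0 : ∀ q ∈ s, 0 ≤ T q) :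
    (∑ q ∈ s, c q • x q) ⬝ᵥ (A⁻¹ *ᵥ (∑ q ∈ s, c q • x q)) ≤ ∑ q ∈ s, c q ^ 2 / T q := by
  set y := ∑ q ∈ s, c q • x q with hy
  set z := A⁻¹ *ᵥ y with hz
  have hAz : A *ᵥ z = y := mulVec_inv_cancel hA y
  have h1 := hT z
  rw [hAz, dotProduct_comm z y] at h1
  have h2 : y ⬝ᵥ z = ∑ q ∈ s, (c q / √(T q)) * (√(T q) * (x q ⬝ᵥ z)) := by
    rw [hy, sum_dotProduct]
    refine Finset.sum_congr rfl fun q hq => ?_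
    rw [smul_dotProduct, smul_eq_mul]
    by_cases h : c q = 0
    · simp [h]
    · have : √(T q) ≠ 0 := (Real.sqrt_pos.mpr (hc q hq h)).ne'
      field_simp
  have h3 := Finset.sum_mul_sq_le_sq_mul_sq s (fun q => c q / √(T q))
    (fun q => √(T q) * (x q ⬝ᵥ z))
  rw [← h2] at h3
  have h4 : ∑ q ∈ s, (c q / √(T q)) ^ 2 = ∑ q ∈ s, c q ^ 2 / T q :=
    Finset.sum_congr rfl fun q hq => by rw [div_pow, Real.sq_sqrt (hT0 q hq)]
  have h5 : ∑ q ∈ s, (√(T q) * (x q ⬝ᵥ z)) ^ 2 = ∑ q ∈ s, T q * (x q ⬝ᵥ z) ^ 2 :=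
    Finset.sum_congr rfl fun q hq => by rw [mul_pow, Real.sq_sqrt (hT0 q hq)]
  rw [h4, h5] at h3
  have h6 : 0 ≤ ∑ q ∈ s, c q ^ 2 / T q :=
    Finset.sum_nonneg fun q hq => div_nonneg (sq_nonneg _) (hT0 q hq)
  have h7 : 0 ≤ y ⬝ᵥ z := by
    refine le_trans (Finset.sum_nonneg fun q hq => ?_) h1
    exact mul_nonneg (hT0 q hq) (sq_nonneg _)
  -- Cauchy-Schwarz and `h1` give `(y·z)² ≤ (∑ c²/T)(y·z)`, and a factor `y·z` cancels.
  by_contra hlt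
  push Not at hlt
  nlinarith

/-- The matrix determinant lemma for a symmetric update of rank one. -/
lemma det_add_vecMulVec_self {A : Matrix (Fin d) (Fin d) ℝ} (hA : A.PosDef) (x : Fin d → ℝ) :
    (A + vecMulVec x x).det = A.det * (1 + x ⬝ᵥ (A⁻¹ *ᵥ x)) := by
  rw [vecMulVec_eq Unit,
    det_add_replicateCol_mul_replicateRow (isUnit_iff_ne_zero.mpr hA.det_pos.ne')]
  congr 2
  rw [det_unique, ← replicateRow_vecMul, Matrix.add_apply, one_apply_eq,
    replicateRow_mul_replicateCol_apply, dotProduct_mulVec]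

lemma posDef_add_vecMulVec_self {A : Matrix (Fin d) (Fin d) ℝ} (hA : A.PosDef)
    (x : Fin d → ℝ) : (A + vecMulVec x x).PosDef :=
  hA.add_posSemidef (by simpa using posSemidef_vecMulVec_self_star x)

lemma vecMulVec_self_mulVec (x z : Fin d → ℝ) : vecMulVec x x *ᵥ z = (x ⬝ᵥ z) • x := by
  ext i
  simp only [mulVec, dotProduct, vecMulVec_apply, Pi.smul_apply, smul_eq_mul, Finset.sum_mul]
  exact Finset.sum_congr rfl fun _ _ => by ring

/-- A consequence of the Sherman-Morrison formula. -/
lemma dotProduct_inv_mulVec_update {A : Matrix (Fin d) (Fin d) ℝ} (hA : A.PosDef)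
    (x v : Fin d → ℝ) (r : ℝ) :
    (v + r • x) ⬝ᵥ ((A + vecMulVec x x)⁻¹ *ᵥ (v + r • x)) = v ⬝ᵥ (A⁻¹ *ᵥ v)
      + (2 * r * (x ⬝ᵥ (A⁻¹ *ᵥ v)) + r ^ 2 * (x ⬝ᵥ (A⁻¹ *ᵥ x)) - (x ⬝ᵥ (A⁻¹ *ᵥ v)) ^ 2)
        / (1 + x ⬝ᵥ (A⁻¹ *ᵥ x)) := by
  have hu : 0 ≤ x ⬝ᵥ (A⁻¹ *ᵥ x) := dotProduct_mulVec_nonneg hA.inv.posSemidef x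
  have hsym : v ⬝ᵥ (A⁻¹ *ᵥ x) = x ⬝ᵥ (A⁻¹ *ᵥ v) :=
    dotProduct_mulVec_comm_of_isHermitian hA.inv.isHermitian v x
  set u := x ⬝ᵥ (A⁻¹ *ᵥ x) with hu_def
  set s := x ⬝ᵥ (A⁻¹ *ᵥ v) with hs_def
  have hne : 1 + u ≠ 0 := by positivity
  -- The solution must be `A⁻¹v` plus a multiple of `A⁻¹x`; matching the coefficient of `x`
  -- determines the multiple.
  have hsol : (A + vecMulVec x x)⁻¹ *ᵥ (v + r • x)
      = A⁻¹ *ᵥ v + ((r - s) / (1 + u)) • (A⁻¹ *ᵥ x) := by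
    rw [← inv_mulVec_cancel (posDef_add_vecMulVec_self hA x)
      (A⁻¹ *ᵥ v + ((r - s) / (1 + u)) • (A⁻¹ *ᵥ x))]
    congr 1
    rw [add_mulVec, vecMulVec_self_mulVec, mulVec_add, mulVec_smul, mulVec_inv_cancel hA,
      mulVec_inv_cancel hA, dotProduct_add, dotProduct_smul, ← hu_def, ← hs_def, add_assoc,
      ← add_smul]
    congr 2
    simp only [smul_eq_mul]
    field_simp
    ring
  rw [hsol]
  simp only [add_dotProduct, dotProduct_add, smul_dotProduct, dotProduct_smul, smul_eq_mul,
    hsym, ← hu_def, ← hs_def]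
  field_simp
  ring

/-- The inequality of the arithmetic and geometric means for the eigenvalues. -/
lemma det_le_trace_div_pow (hd : 0 < d) {A : Matrix (Fin d) (Fin d) ℝ} (hA : A.PosSemidef) :
    A.det ≤ (A.trace / d) ^ d := by
  have hnn : ∀ i, 0 ≤ hA.isHermitian.eigenvalues i := hA.eigenvalues_nonneg
  rw [hA.isHermitian.det_eq_prod_eigenvalues, hA.isHermitian.trace_eq_sum_eigenvalues]
  have hd' : (0 : ℝ) < d := by exact_mod_cast hd
  simp only [RCLike.ofReal_real_eq_id, id_eq]
  have := Real.geom_mean_le_arith_mean_weighted Finset.univ (fun _ : Fin d => (1 / d : ℝ))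
    hA.isHermitian.eigenvalues (fun _ _ => by positivity) (by simp; field_simp)
    (fun i _ => hnn i)
  have h2 := pow_le_pow_left₀ (Finset.prod_nonneg fun i _ => Real.rpow_nonneg (hnn i) _) this d
  rw [← Finset.prod_pow] at h2
  have h3 : ∀ i, (hA.isHermitian.eigenvalues i ^ (1 / d : ℝ)) ^ d
      = hA.isHermitian.eigenvalues i := fun i => by
    rw [one_div, Real.rpow_inv_natCast_pow (hnn i) hd.ne']
  simp only [h3] at h2
  refine h2.trans (le_of_eq ?_)
  congr 1
  simp [Finset.mul_sum, div_eq_inv_mul]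

end LinearAlgebra

/-! ### A one-dimensional exponential moment -/

section ExponentialMoment

open scoped ENNReal

/-- A Gaussian mixture of exponentials is the exponential of a quadratic polynomial. -/
lemma lintegral_exp_affine_gaussian (α β : ℝ) :
    ∫⁻ g, ENNReal.ofReal (Real.exp (α + β * g)) ∂(gaussianReal 0 1)
      = ENNReal.ofReal (Real.exp (α + β ^ 2 / 2)) := by
  have hmgf : mgf id (gaussianReal 0 1) β = Real.exp (β ^ 2 / 2) := by
    have := mgf_gaussianReal (p := gaussianReal 0 1) (X := id) (μ := 0) (v := 1) (by simp) β
    simpa using this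
  have hint : Integrable (fun g => Real.exp (β * g)) (gaussianReal 0 1) := by
    simpa using integrable_exp_mul_gaussianReal (μ := 0) (v := 1) β
  rw [← ofReal_integral_eq_lintegral_ofReal]
  · congr 1
    simp only [Real.exp_add]
    rw [integral_const_mul, ← hmgf]
    rfl
  · simpa only [Real.exp_add] using hint.const_mul _
  · exact Filter.Eventually.of_forall fun _ => (Real.exp_pos _).le

/-- The integral of an exponential of a quadratic polynomial against the Gaussian measure. -/
lemma lintegral_exp_sq_gaussian {u s : ℝ} (hu : 0 ≤ u) :
    ∫⁻ g, ENNReal.ofReal (Real.exp ((s / (1 + u) + √(u / (1 + u)) * g) ^ 2 / 2))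
        ∂(gaussianReal 0 1)
      = ENNReal.ofReal (√(1 + u) * Real.exp (s ^ 2 / (2 * (1 + u)))) := by
  have h1u : 0 < 1 + u := by positivity
  obtain ⟨v, hv⟩ : ∃ v : ℝ≥0, (v : ℝ) = 1 + u := ⟨Real.toNNReal (1 + u), by simp [h1u.le]⟩
  have hv0 : v ≠ 0 := by
    rintro rfl
    simp only [NNReal.coe_zero] at hv
    exact h1u.ne hv
  -- Completing the square against the standard normal density gives a normal density of mean `m`
  -- and variance `1 + u`, up to the constant on the right-hand side.
  set m : ℝ := s * √(u / (1 + u)) with hm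
  have hsq : √(u / (1 + u)) ^ 2 = u / (1 + u) := Real.sq_sqrt (by positivity)
  rw [gaussianReal_of_var_ne_zero _ one_ne_zero, lintegral_withDensity_eq_lintegral_mul _
    (measurable_gaussianPDF 0 1) (by fun_prop)]
  have hpt : ∀ g : ℝ, (gaussianPDF 0 1 * fun g => ENNReal.ofReal
      (Real.exp ((s / (1 + u) + √(u / (1 + u)) * g) ^ 2 / 2))) g
      = ENNReal.ofReal (√(1 + u) * Real.exp (s ^ 2 / (2 * (1 + u)))) * gaussianPDF m v g := by
    intro g
    simp only [Pi.mul_apply, gaussianPDF]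
    rw [← ENNReal.ofReal_mul (gaussianPDFReal_nonneg _ _ _), ← ENNReal.ofReal_mul (by positivity)]
    congr 1
    simp only [gaussianPDFReal, NNReal.coe_one, hv, mul_one, sub_zero]
    have e1 : √(2 * Real.pi * (1 + u)) = √(2 * Real.pi) * √(1 + u) :=
      Real.sqrt_mul (by positivity) _
    rw [e1]
    have hne : √(1 + u) ≠ 0 := by positivity
    have hne2 : √(2 * Real.pi) ≠ 0 := by positivity
    rw [mul_assoc, ← Real.exp_add]
    have : √(1 + u) * Real.exp (s ^ 2 / (2 * (1 + u))) *
        ((√(2 * Real.pi) * √(1 + u))⁻¹ * Real.exp (-(g - m) ^ 2 / (2 * (1 + u))))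
        = (√(2 * Real.pi))⁻¹ * (Real.exp (s ^ 2 / (2 * (1 + u))) *
          Real.exp (-(g - m) ^ 2 / (2 * (1 + u)))) := by
      field_simp
    rw [this, ← Real.exp_add]
    congr 2
    rw [hm]
    generalize √(u / (1 + u)) = r at hsq
    have e2 : u = r ^ 2 * (1 + u) := by rw [hsq]; field_simp
    field_simp
    linear_combination (-s ^ 2 - g ^ 2 * (1 + u)) * e2
  simp only [hpt]
  rw [lintegral_const_mul _ (measurable_gaussianPDF m v), lintegral_gaussianPDF_eq_one m hv0,
    mul_one]

/-- The exponential moment that governs one update of the self-normalised process. -/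
lemma lintegral_exp_quadratic_le {Ω : Type*} [MeasurableSpace Ω] {μ : Measure Ω}
    [IsProbabilityMeasure μ] {X : Ω → ℝ} (hX : Measurable X) {R : ℝ≥0} (hR : R ≠ 0)
    (hsub : HasSubgaussianMGF X (R ^ 2) μ) {u : ℝ} (hu : 0 ≤ u) (s : ℝ) :
    ∫⁻ ω, ENNReal.ofReal
        (Real.exp ((2 * X ω * s + X ω ^ 2 * u) / (2 * R ^ 2 * (1 + u)))) ∂μ
      ≤ ENNReal.ofReal (√(1 + u) * Real.exp (s ^ 2 / (2 * R ^ 2 * (1 + u)))) := by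
  have hR' : (0 : ℝ) < R := by positivity
  have h1u : 0 < 1 + u := by positivity
  have hsq : √(u / (1 + u)) ^ 2 = u / (1 + u) := Real.sq_sqrt (by positivity)
  -- The square of `X` is linearised: the exponential of a quadratic is a Gaussian mixture of
  -- exponentials linear in `X`. After exchanging the integrals, the sub-Gaussian bound applies for
  -- each fixed `g`.
  have step1 : ∀ ω, ENNReal.ofReal
      (Real.exp ((2 * X ω * s + X ω ^ 2 * u) / (2 * R ^ 2 * (1 + u))))
      = ∫⁻ g, ENNReal.ofReal (Real.exp (((s / R / (1 + u) + √(u / (1 + u)) * g) / R) * X ω))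
        ∂(gaussianReal 0 1) := by
    intro ω
    have := lintegral_exp_affine_gaussian (s / R / (1 + u) / R * X ω) (√(u / (1 + u)) / R * X ω)
    rw [mul_pow, div_pow, hsq] at this
    convert this.symm using 3
    · field_simp
    · ring_nf
  simp_rw [step1]
  rw [lintegral_lintegral_swap]
  swap
  · apply Measurable.aemeasurable
    fun_prop
  calc _ ≤ ∫⁻ g, ENNReal.ofReal (Real.exp ((s / R / (1 + u) + √(u / (1 + u)) * g) ^ 2 / 2))
        ∂(gaussianReal 0 1) := by
        refine lintegral_mono fun g => ?_
        rw [← ofReal_integral_eq_lintegral_ofReal (hsub.integrable_exp_mul _)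
          (Filter.Eventually.of_forall fun _ => (Real.exp_pos _).le)]
        refine ENNReal.ofReal_le_ofReal ((hsub.mgf_le _).trans (le_of_eq ?_))
        congr 1
        push_cast
        field_simp
    _ = _ := by
        rw [lintegral_exp_sq_gaussian hu]
        congr 3
        field_simp

end ExponentialMoment

/-! ### Selection rules -/

section Selection

variable {n : ℕ}

lemma mem_argmaxSet {g : Fin n → ℝ} {i : Fin n} : i ∈ argmaxSet g ↔ ∀ j, g j ≤ g i := by
  simp [argmaxSet]

lemma argmaxSet_nonempty (hn : 0 < n) (g : Fin n → ℝ) : (argmaxSet g).Nonempty := by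
  have : Nonempty (Fin n) := ⟨⟨0, hn⟩⟩
  obtain ⟨i, hi⟩ := Finite.exists_max g
  exact ⟨i, mem_argmaxSet.mpr hi⟩

end Selection

/-! ### Features, directions and allocation ratios -/

namespace LGInput

variable {n d : ℕ} (I : LGInput n d)

lemma direction_swap (p : List (Fin n)) (i j : Fin n) :
    I.direction p j i = -I.direction p i j := by
  simp [direction]

lemma feature_append (p : List (Fin n)) (a : Fin n) {l : ℕ} (hl : l ≤ p.length) (b : Fin n) :
    I.feature (p ++ [a]) l b = I.feature p l b := by
  rw [feature, feature, List.take_append_of_le_length hl]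

lemma rho_nonneg (p : List (Fin n)) (i j : Fin n) : 0 ≤ I.rho p i j :=
  Finset.sum_nonneg fun _ _ => Finset.sum_nonneg fun _ _ => abs_nonneg _

lemma pstar_nonneg (p : List (Fin n)) (i j : Fin n) (l : ℕ) (a : Fin n) :
    0 ≤ I.pstar p i j l a :=
  div_nonneg (abs_nonneg _) (I.rho_nonneg p i j)

lemma IsAdmissible.direction_eq {I : LGInput n d} (hI : I.IsAdmissible) (p : List (Fin n))
    (i j : Fin n) : I.direction p i j
      = ∑ q ∈ Finset.range (p.length + 1) ×ˢ (Finset.univ : Finset (Fin n)),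
          I.wstar p i j q.1 q.2 • I.feature p q.1 q.2 := by
  rw [Finset.sum_product]
  exact (hI.1 p i j).1

lemma abs_wstar_le_rho (p : List (Fin n)) (i j : Fin n) {q : ℕ × Fin n}
    (hq : q ∈ Finset.range (p.length + 1) ×ˢ (Finset.univ : Finset (Fin n))) :
    |I.wstar p i j q.1 q.2| ≤ I.rho p i j := by
  rw [rho, ← Finset.sum_product (f := fun q : ℕ × Fin n => |I.wstar p i j q.1 q.2|)]
  exact Finset.single_le_sum (f := fun q : ℕ × Fin n => |I.wstar p i j q.1 q.2|)
    (fun _ _ => abs_nonneg _) hq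

/-- This survives `rho = 0`, where the quotient `pstar` is zero by convention: all weights vanish
then as well. -/
lemma abs_wstar_eq (p : List (Fin n)) (i j : Fin n) {q : ℕ × Fin n}
    (hq : q ∈ Finset.range (p.length + 1) ×ˢ (Finset.univ : Finset (Fin n))) :
    |I.wstar p i j q.1 q.2| = I.rho p i j * I.pstar p i j q.1 q.2 := by
  rw [pstar]
  by_cases h : I.rho p i j = 0
  · have := I.abs_wstar_le_rho p i j hq
    rw [h] at this
    rw [h, zero_mul]
    exact le_antisymm this (abs_nonneg _)
  · field_simp

end LGInput

/-! ### The chosen elements and the chosen arm -/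

namespace LGState

variable {n d : ℕ} (I : LGInput n d) (w : Fin d → ℝ) (noise : ℕ → ℝ) (s : LGState n d)

/-- The arms that are available in the current round. -/
def arms : Finset (ℕ × Fin n) :=
  Finset.range (s.picks.length + 1) ×ˢ (Finset.univ : Finset (Fin n))

lemma mem_arms {q : ℕ × Fin n} : q ∈ s.arms ↔ q.1 ≤ s.picks.length := by
  simp [arms]

lemma sum_arms {M : Type*} [AddCommMonoid M] (f : ℕ → Fin n → M) :
    ∑ l' ∈ Finset.range (s.picks.length + 1), ∑ a, f l' a = ∑ q ∈ s.arms, f q.1 q.2 :=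
  (Finset.sum_product _ _ fun q : ℕ × Fin n => f q.1 q.2).symm

lemma le_iSel (hI : I.IsAdmissible) (hn : 0 < n) (j : Fin n) :
    marginal I.F s.sol j ⬝ᵥ s.what ≤ marginal I.F s.sol (s.iSel I) ⬝ᵥ s.what :=
  mem_argmaxSet.mp (hI.2.1 s.pulls (argmaxSet fun i => marginal I.F s.sol i ⬝ᵥ s.what)
    (argmaxSet_nonempty hn _)) j

lemma ucb_le_B (hI : I.IsAdmissible) (hn : 0 < n) (j : Fin n) : s.ucb I j ≤ s.B I :=
  mem_argmaxSet.mp (hI.2.2.1 s.pulls _ (argmaxSet_nonempty hn _)) j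

/-- Since `i_t` maximises the estimated gain, the estimated advantage of `j_t` over it is
nonpositive and only the width remains. -/
lemma B_le_beta (hI : I.IsAdmissible) (hn : 0 < n) :
    s.B I ≤ s.beta I (s.jSel I) (s.iSel I) := by
  have := s.le_iSel I hI hn (s.jSel I)
  rw [B, ucb]
  linarith

lemma direction_ne_zero_of_B_pos (hI : I.IsAdmissible) (hn : 0 < n) (hB : 0 < s.B I) :
    I.direction s.picks (s.iSel I) (s.jSel I) ≠ 0 := by
  intro h
  have := s.B_le_beta I hI hn
  rw [beta, I.direction_swap, h] at this
  simp [matNorm] at this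
  linarith

lemma mem_armSet {q : ℕ × Fin n} : q ∈ s.armSet I ↔
    q ∈ s.arms ∧ 0 < I.pstar s.picks (s.iSel I) (s.jSel I) q.1 q.2 ∧
    ∀ q' ∈ s.arms, 0 < I.pstar s.picks (s.iSel I) (s.jSel I) q'.1 q'.2 →
      (s.T q.1 q.2 : ℝ) / I.pstar s.picks (s.iSel I) (s.jSel I) q.1 q.2
        ≤ (s.T q'.1 q'.2 : ℝ) / I.pstar s.picks (s.iSel I) (s.jSel I) q'.1 q'.2 := by
  simp only [armSet, Finset.mem_filter, and_assoc, and_imp]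
  rfl

/-- If all ratios vanished, so would all weights of the linear program, and its constraint would
make the direction zero. Nonemptiness is needed because nothing is assumed about tie-breaking on the
empty set. -/
lemma armSet_nonempty (hI : I.IsAdmissible)
    (hne : I.direction s.picks (s.iSel I) (s.jSel I) ≠ 0) : (s.armSet I).Nonempty := by
  classical
  set p : ℕ × Fin n → ℝ := fun q => I.pstar s.picks (s.iSel I) (s.jSel I) q.1 q.2 with hp
  have hsupp : (s.arms.filter fun q => 0 < p q).Nonempty := by
    by_contra hcon
    rw [Finset.not_nonempty_iff_eq_empty, Finset.filter_eq_empty_iff] at hcon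
    apply hne
    rw [hI.direction_eq]
    refine Finset.sum_eq_zero fun q hq => ?_
    have h0 : p q = 0 := le_antisymm (not_lt.mp (hcon hq)) (I.pstar_nonneg _ _ _ _ _)
    have := I.abs_wstar_eq s.picks (s.iSel I) (s.jSel I) hq
    rw [show I.pstar s.picks (s.iSel I) (s.jSel I) q.1 q.2 = 0 from h0, mul_zero,
      abs_eq_zero] at this
    rw [this, zero_smul]
  obtain ⟨q, hq, hmin⟩ := Finset.exists_min_image _ (fun q => (s.T q.1 q.2 : ℝ) / p q) hsupp
  rw [Finset.mem_filter] at hq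
  exact ⟨q, (s.mem_armSet I).mpr ⟨hq.1, hq.2, fun q' hq' hp' =>
    hmin q' (Finset.mem_filter.mpr ⟨hq', hp'⟩)⟩⟩

lemma armSel_mem (hI : I.IsAdmissible)
    (hne : I.direction s.picks (s.iSel I) (s.jSel I) ≠ 0) : s.armSel I ∈ s.armSet I :=
  hI.2.2.2 _ _ (s.armSet_nonempty I hI hne)

/-! ### Invariants of the run -/

/-- The memory is consistent with a run of the algorithm. -/
structure WellFormed : Prop where
  swept_le : s.swept ≤ n
  length_le : s.picks.length ≤ I.κ
  mem_pulls : ∀ q : ℕ × Fin n, q ∈ s.pulls ↔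
    q.1 < s.picks.length ∨ (q.1 = s.picks.length ∧ q.2.val < s.swept)
  A_eq : s.A = I.lam • (1 : Matrix (Fin d) (Fin d) ℝ)
    + (s.pulls.map fun q => vecMulVec (I.feature s.picks q.1 q.2)
        (I.feature s.picks q.1 q.2)).sum

variable {I s} in
lemma WellFormed.mem_arms_of_mem_pulls (hs : s.WellFormed I) {q : ℕ × Fin n}
    (hq : q ∈ s.pulls) : q ∈ s.arms := by
  rw [mem_arms]
  rcases (hs.mem_pulls q).mp hq with h | h
  · exact h.le
  · exact h.1.le

lemma wellFormed_start : (start I).WellFormed I where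
  swept_le := Nat.zero_le _
  length_le := Nat.zero_le _
  mem_pulls q := by simp [start]
  A_eq := by simp [start]

variable {I w noise s}

lemma step_of_halted (h : s.Halted I) : step I w noise s = s := by
  rw [step, if_pos h]

lemma step_of_sweep (h : ¬ s.Halted I) (h2 : s.swept < n) : step I w noise s
    = { s.sample I w noise (s.picks.length, ⟨s.swept, h2⟩) with swept := s.swept + 1 } := by
  rw [step, if_neg h, dif_pos h2]

lemma step_of_stop (h : ¬ s.Halted I) (h2 : s.Stops I) :
    step I w noise s = s.nextRound I := by
  rw [step, if_neg h, dif_neg (by rw [h2.1]; exact lt_irrefl _), if_pos h2.2]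

lemma step_of_sample (h : ¬ s.Halted I) (h2 : s.swept = n) (h3 : ¬ s.Stops I) :
    step I w noise s = s.sample I w noise (s.armSel I) := by
  rw [step, if_neg h, dif_neg (by rw [h2]; exact lt_irrefl _), if_neg (fun h4 => h3 ⟨h2, h4⟩)]

lemma B_pos_of_not_stops (hε : 0 < I.ε) (h2 : s.swept = n) (h3 : ¬ s.Stops I) : 0 < s.B I := by
  by_contra hB
  exact h3 ⟨h2, (not_lt.mp hB).trans (div_nonneg hε.le (Nat.cast_nonneg _))⟩

lemma WellFormed.step (hs : s.WellFormed I) (hI : I.IsAdmissible) (hn : 0 < n) (hε : 0 < I.ε) :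
    (step I w noise s).WellFormed I := by
  by_cases h : s.Halted I
  · rwa [step_of_halted h]
  rcases hs.swept_le.lt_or_eq with h2 | h2
  · rw [step_of_sweep h h2]
    refine ⟨h2, hs.length_le, fun q => ?_, ?_⟩
    · simp only [sample, List.mem_cons, hs.mem_pulls]
      rcases q with ⟨l, a⟩
      simp only [Prod.mk.injEq, Fin.ext_iff]
      omega
    · simp only [sample, List.map_cons, List.sum_cons]
      rw [hs.A_eq]
      abel
  · by_cases h3 : s.Stops I
    · rw [step_of_stop h h3]
      refine ⟨Nat.zero_le _, ?_, fun q => ?_, ?_⟩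
      · have : s.picks.length ≠ I.κ := h
        have := hs.length_le
        simp only [nextRound, List.length_append, List.length_singleton]
        omega
      · have := q.2.isLt
        simp only [nextRound, hs.mem_pulls, List.length_append, List.length_singleton]
        omega
      · simp only [nextRound]
        rw [hs.A_eq]
        congr 2
        refine List.map_congr_left fun q hq => ?_
        -- A sampled arm belongs to a round no later than the current one, so its feature does not
        -- see the appended element.
        rw [I.feature_append _ _ (s.mem_arms.mp (hs.mem_arms_of_mem_pulls hq))]
    · rw [step_of_sample h h2 h3]
      have hmem := (s.mem_armSet I).mp (s.armSel_mem I hI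
        (s.direction_ne_zero_of_B_pos I hI hn (B_pos_of_not_stops hε h2 h3)))
      have hle := s.mem_arms.mp hmem.1
      refine ⟨h2.le, hs.length_le, fun q => ?_, ?_⟩
      · simp only [sample, List.mem_cons, hs.mem_pulls]
        refine ⟨?_, Or.inr⟩
        rintro (rfl | h)
        -- The chosen arm is available and the sweep is complete, so it already occurs among the
        -- sampled arms.
        · have := (s.armSel I).2.isLt
          omega
        · exact h
      · simp only [sample, List.map_cons, List.sum_cons]
        rw [hs.A_eq]
        abel

lemma run_succ (k : ℕ) : run I w noise (k + 1) = step I w noise (run I w noise k) := by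
  rw [run, run, Function.iterate_succ_apply']

lemma wellFormed_run (hI : I.IsAdmissible) (hn : 0 < n) (hε : 0 < I.ε) (k : ℕ) :
    (run I w noise k).WellFormed I := by
  induction k with
  | zero => exact wellFormed_start I
  | succ k ih =>
    rw [run_succ]
    exact ih.step hI hn hε

/-- Every round, including the current one, has swept all its arms. This is what permits dividing by
the counts in the bound for the width. -/
lemma WellFormed.T_pos (hs : s.WellFormed I) (h : s.swept = n) {q : ℕ × Fin n}
    (hq : q ∈ s.arms) : 0 < s.T q.1 q.2 := by
  rw [T, List.count_pos_iff, hs.mem_pulls]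
  have := s.mem_arms.mp hq
  have := q.2.isLt
  simp only
  omega

/-- Reconciles the equality test that `T` is elaborated with and the one coming from decidable
equality, which the lemmas on sums of counts use. -/
lemma T_eq_count (q : ℕ × Fin n) :
    s.T q.1 q.2 = @List.count _ instBEqOfDecidableEq q s.pulls := by
  rw [T]
  congr 1
  exact lawful_beq_subsingleton _ _

lemma WellFormed.length_pulls (hs : s.WellFormed I) :
    s.pulls.length = ∑ q ∈ s.arms, s.T q.1 q.2 := by
  have h := Multiset.sum_count_eq_card (s := s.arms) (m := (s.pulls : Multiset (ℕ × Fin n)))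
    (fun q hq => hs.mem_arms_of_mem_pulls (by simpa using hq))
  simp only [T_eq_count]
  simpa using h.symm

lemma WellFormed.Ntot_eq (hs : s.WellFormed I) : s.Ntot = s.pulls.length := by
  rw [hs.length_pulls, Ntot, sum_arms]

lemma dotProduct_sum_vecMulVec (l : List (Fin d → ℝ)) (z : Fin d → ℝ) :
    z ⬝ᵥ ((l.map fun x => vecMulVec x x).sum *ᵥ z) = (l.map fun x => (x ⬝ᵥ z) ^ 2).sum := by
  induction l with
  | nil => simp
  | cons x l ih =>
    simp only [List.map_cons, List.sum_cons, add_mulVec, dotProduct_add, ih,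
      vecMulVec_self_mulVec, dotProduct_smul, smul_eq_mul, dotProduct_comm z x]
    ring

/-- Samples are grouped by arm. In this form `A` visibly dominates both the regulariser and the
count-weighted sum of features, which are the two hypotheses needed to bound `A⁻¹`. -/
lemma WellFormed.dotProduct_A (hs : s.WellFormed I) (z : Fin d → ℝ) :
    z ⬝ᵥ (s.A *ᵥ z) = I.lam * (z ⬝ᵥ z)
      + ∑ q ∈ s.arms, (s.T q.1 q.2 : ℝ) * (I.feature s.picks q.1 q.2 ⬝ᵥ z) ^ 2 := by
  have h1 := dotProduct_sum_vecMulVec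
    (s.pulls.map fun q => I.feature s.picks q.1 q.2) z
  simp only [List.map_map, Function.comp_def] at h1
  rw [hs.A_eq, add_mulVec, dotProduct_add, smul_mulVec, one_mulVec, dotProduct_smul, smul_eq_mul,
    h1]
  congr 1
  rw [Finset.sum_list_map_count]
  have hsub : s.pulls.toFinset ⊆ s.arms := fun q hq =>
    hs.mem_arms_of_mem_pulls (List.mem_toFinset.mp hq)
  rw [Finset.sum_subset hsub]
  · refine Finset.sum_congr rfl fun q _ => ?_
    rw [nsmul_eq_mul, T_eq_count]
  · intro q _ hq
    rw [← T_eq_count, T, List.count_eq_zero_of_not_mem (fun h => hq (List.mem_toFinset.mpr h)),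
      zero_smul]

lemma WellFormed.posDef (hs : s.WellFormed I) (hlam : 0 < I.lam) : s.A.PosDef := by
  rw [hs.A_eq]
  refine PosDef.add_posSemidef (PosDef.one.smul hlam) ?_
  generalize s.pulls = l
  induction l with
  | nil => simpa using PosSemidef.zero
  | cons q l ih =>
    simp only [List.map_cons, List.sum_cons]
    exact PosSemidef.add (by
      simpa using posSemidef_vecMulVec_self_star (I.feature s.picks q.1 q.2)) ih

lemma WellFormed.trace_A_le (hs : s.WellFormed I) {L : ℝ}
    (hL : ∀ p l a, I.feature p l a ⬝ᵥ I.feature p l a ≤ L ^ 2) :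
    s.A.trace ≤ I.lam * d + s.pulls.length * L ^ 2 := by
  rw [hs.A_eq, trace_add, trace_smul, trace_one, Fintype.card_fin, smul_eq_mul]
  gcongr
  generalize s.pulls = l
  induction l with
  | nil => simp
  | cons q l ih =>
    simp only [List.map_cons, List.sum_cons, trace_add, trace_vecMulVec, List.length_cons]
    have := hL s.picks q.1 q.2
    push_cast
    linarith

/-- The arm to be sampled has been sampled rarely in comparison with the confidence width. -/
lemma WellFormed.T_armSel_mul_le (hs : s.WellFormed I) (hI : I.IsAdmissible)
    (hlam : 0 < I.lam) (h2 : s.swept = n)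
    (hne : I.direction s.picks (s.iSel I) (s.jSel I) ≠ 0) :
    (s.T (s.armSel I).1 (s.armSel I).2 : ℝ)
        * matNorm s.A⁻¹ (I.direction s.picks (s.jSel I) (s.iSel I)) ^ 2
      ≤ I.pstar s.picks (s.iSel I) (s.jSel I) (s.armSel I).1 (s.armSel I).2
        * I.rho s.picks (s.iSel I) (s.jSel I) ^ 2 := by
  obtain ⟨hq, hp, hmin⟩ := (s.mem_armSet I).mp (s.armSel_mem I hI hne)
  set q := s.armSel I
  set i := s.iSel I
  set j := s.jSel I
  have hA := hs.posDef hlam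
  have hT : ∀ q' ∈ s.arms, (0 : ℝ) < s.T q'.1 q'.2 := fun q' hq' => by
    exact_mod_cast hs.T_pos h2 hq'
  have h1 := dotProduct_inv_mulVec_sum_le hA s.arms (fun q => I.feature s.picks q.1 q.2)
    (fun q => (s.T q.1 q.2 : ℝ)) (fun z => by
      rw [hs.dotProduct_A]
      have : 0 ≤ I.lam * (z ⬝ᵥ z) := mul_nonneg hlam.le (by
        simpa using dotProduct_star_self_nonneg z)
      linarith) (fun q => I.wstar s.picks i j q.1 q.2) (fun q' hq' _ => hT q' hq')
      (fun q' hq' => (hT q' hq').le)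
  have h3 : ∑ q ∈ s.arms, I.wstar s.picks i j q.1 q.2 • I.feature s.picks q.1 q.2
      = I.direction s.picks i j := (hI.direction_eq _ _ _).symm
  simp only [h3] at h1
  rw [I.direction_swap, matNorm_neg, matNorm,
    Real.sq_sqrt (dotProduct_mulVec_nonneg hA.inv.posSemidef _)]
  have hTq := hT q hq
  -- One factor `|w*|` is kept and the other written as `ρ p*`; by the choice of `q`, the ratio
  -- `p*/T` is largest at `q`. Summing the kept factors gives the second `ρ`.
  have h4 : ∑ q' ∈ s.arms, I.wstar s.picks i j q'.1 q'.2 ^ 2 / (s.T q'.1 q'.2 : ℝ)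
      ≤ ∑ q' ∈ s.arms, |I.wstar s.picks i j q'.1 q'.2|
          * (I.rho s.picks i j * I.pstar s.picks i j q.1 q.2 / (s.T q.1 q.2 : ℝ)) := by
    refine Finset.sum_le_sum fun q' hq' => ?_
    have hTq' := hT q' hq'
    rw [← sq_abs, sq, mul_div_assoc]
    refine mul_le_mul_of_nonneg_left ?_ (abs_nonneg _)
    rw [I.abs_wstar_eq _ _ _ hq', mul_div_assoc, mul_div_assoc]
    refine mul_le_mul_of_nonneg_left ?_ (I.rho_nonneg _ _ _)
    rcases (I.pstar_nonneg s.picks i j q'.1 q'.2).eq_or_lt with h0 | h0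
    · rw [← h0, zero_div]
      exact div_nonneg hp.le hTq.le
    · have := hmin q' hq' h0
      rw [div_le_div_iff₀ hp h0] at this
      rw [div_le_div_iff₀ hTq' hTq]
      linarith
  rw [← Finset.sum_mul] at h4
  have h5 : ∑ q' ∈ s.arms, |I.wstar s.picks i j q'.1 q'.2| = I.rho s.picks i j :=
    (s.sum_arms fun l a => |I.wstar s.picks i j l a|).symm
  rw [h5] at h4
  calc _ ≤ (s.T q.1 q.2 : ℝ) * (I.rho s.picks i j
        * (I.rho s.picks i j * I.pstar s.picks i j q.1 q.2 / (s.T q.1 q.2 : ℝ))) :=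
        mul_le_mul_of_nonneg_left (h1.trans h4) hTq.le
    _ = _ := by field_simp

end LGState

/-! ### The analysis of a round -/

namespace LGState

variable {n d : ℕ}

/-- The confidence ellipsoid around the estimate contains the true weight vector. -/
def Confident (I : LGInput n d) (w : Fin d → ℝ) (s : LGState n d) : Prop :=
  ∀ x : Fin d → ℝ, |x ⬝ᵥ (s.what - w)| ≤ s.C I * matNorm s.A⁻¹ x

variable {I : LGInput n d} {w : Fin d → ℝ} {noise : ℕ → ℝ} {s s₀ : LGState n d} {L G : ℝ}

/-- The estimated advantage of `j` over `i_t` errs by at most the width. Both the greedy step and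
the gap bounds rest on this. -/
lemma Confident.sub_le_ucb (hc : s.Confident I w) (j : Fin n) :
    marginal I.F s.sol j ⬝ᵥ w - marginal I.F s.sol (s.iSel I) ⬝ᵥ w ≤ s.ucb I j := by
  have h := (abs_le.mp (hc (I.direction s.picks j (s.iSel I)))).1
  rw [LGInput.direction, dotProduct_sub, sub_dotProduct, sub_dotProduct] at h
  rw [ucb, beta, LGInput.direction]
  simp only [sol] at h ⊢
  linarith

lemma Confident.gap_iSel_le_B (hc : s.Confident I w) (hI : I.IsAdmissible) (hn : 0 < n) :
    s.gap I w (s.iSel I) ≤ s.B I := by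
  have : Nonempty (Fin n) := ⟨⟨0, hn⟩⟩
  rw [gap, sub_le_iff_le_add]
  refine ciSup_le fun a => ?_
  have := (hc.sub_le_ucb a).trans (s.ucb_le_B I hI hn a)
  linarith

/-- While the round goes on, the confidence width is large. -/
lemma Confident.lt_beta (hc : s.Confident I w) (hI : I.IsAdmissible) (hn : 0 < n)
    (hε : 0 < I.ε) (h2 : s.swept = n) (h3 : ¬ s.Stops I) :
    max (I.ε / I.κ) ((max (s.gap I w (s.iSel I)) (s.gap I w (s.jSel I)) + I.ε / I.κ) / 3)
      < s.beta I (s.jSel I) (s.iSel I) := by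
  have hB : I.ε / I.κ < s.B I := by
    by_contra h
    exact h3 ⟨h2, not_lt.mp h⟩
  have hεκ : 0 ≤ I.ε / I.κ := div_nonneg hε.le (Nat.cast_nonneg _)
  have hBb := s.B_le_beta I hI hn
  have hi := hc.gap_iSel_le_B hI hn
  have hj : s.gap I w (s.jSel I)
      ≤ s.B I + (marginal I.F s.sol (s.iSel I) ⬝ᵥ w - marginal I.F s.sol (s.jSel I) ⬝ᵥ w) := by
    rw [gap] at hi ⊢
    linarith
  have h := (abs_le.mp (hc (I.direction s.picks (s.jSel I) (s.iSel I)))).2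
  rw [LGInput.direction, dotProduct_sub, sub_dotProduct, sub_dotProduct] at h
  have hB' : s.B I = marginal I.F s.sol (s.jSel I) ⬝ᵥ s.what
      - marginal I.F s.sol (s.iSel I) ⬝ᵥ s.what + s.beta I (s.jSel I) (s.iSel I) := rfl
  have hb : s.beta I (s.jSel I) (s.iSel I) = s.C I * matNorm s.A⁻¹
    (marginal I.F s.picks.toFinset (s.jSel I) - marginal I.F s.picks.toFinset (s.iSel I)) := rfl
  rw [← hb] at h
  simp only [sol] at hj hB' h
  -- The confidence bound for the pair gives true gain of `i_t` minus that of `j_t` at most `2β -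
  -- B`; adding the gap of `i_t`, at most `B`, gives `2β`. With `ε/κ < B ≤ β` the numerator below is
  -- less than `3β`, whence the `3` in the complexity.
  have hj2 : s.gap I w (s.jSel I) ≤ 2 * s.beta I (s.jSel I) (s.iSel I) := by linarith
  refine max_lt (hB.trans_le hBb) ?_
  rcases max_cases (s.gap I w (s.iSel I)) (s.gap I w (s.jSel I)) with h | h <;>
    rw [h.1] <;> linarith

lemma H_nonneg (s : LGState n d) (q : ℕ × Fin n) : 0 ≤ s.H I w q.1 q.2 :=
  Real.iSup_nonneg fun _ => div_nonneg
    (mul_nonneg (I.pstar_nonneg _ _ _ _ _) (sq_nonneg _)) (sq_nonneg _)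

lemma Htot_eq (s : LGState n d) : s.Htot I w = ∑ q ∈ s.arms, s.H I w q.1 q.2 :=
  s.sum_arms (s.H I w)

lemma Htot_nonneg (s : LGState n d) : 0 ≤ s.Htot I w := by
  rw [Htot_eq]
  exact Finset.sum_nonneg fun q _ => s.H_nonneg q

lemma H_congr (h : s.picks = s₀.picks) : s.H I w = s₀.H I w := by
  have hsol : s.sol = s₀.sol := by rw [sol, sol, h]
  have hgap : s.gap I w = s₀.gap I w := by
    funext i
    rw [gap, gap, hsol]
  funext l a
  rw [H, H, hgap, h]

lemma arms_congr (h : s.picks = s₀.picks) : s.arms = s₀.arms := by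
  rw [arms, arms, h]

/-- An arm that is sampled after the initial samples of the round has been sampled rarely. -/
lemma T_armSel_le (hs : s.WellFormed I) (hc : s.Confident I w) (hI : I.IsAdmissible)
    (hn : 0 < n) (hε : 0 < I.ε) (hlam : 0 < I.lam) (hh : ¬ s.Halted I) (h2 : s.swept = n)
    (h3 : ¬ s.Stops I) (hG : s.C I ^ 2 ≤ G) :
    (s.T (s.armSel I).1 (s.armSel I).2 : ℝ) ≤ G * s.H I w (s.armSel I).1 (s.armSel I).2 := by
  have hκ : (0 : ℝ) < I.κ := by
    have h1 := hs.length_le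
    have h4 : s.picks.length ≠ I.κ := hh
    exact_mod_cast (by omega : 0 < I.κ)
  have hlt := hc.lt_beta hI hn hε h2 h3
  have hT := hs.T_armSel_mul_le hI hlam h2
    (s.direction_ne_zero_of_B_pos I hI hn (B_pos_of_not_stops hε h2 h3))
  set q := s.armSel I
  set i := s.iSel I
  set j := s.jSel I
  set ζ := max (I.ε / I.κ) ((max (s.gap I w i) (s.gap I w j) + I.ε / I.κ) / 3) with hζ
  have hζ0 : 0 < ζ := lt_max_of_lt_left (div_pos hε hκ)
  have hH : I.pstar s.picks i j q.1 q.2 * I.rho s.picks i j ^ 2 / ζ ^ 2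
      ≤ s.H I w q.1 q.2 :=
    le_ciSup (f := fun p : Fin n × Fin n =>
      I.pstar s.picks p.1 p.2 q.1 q.2 * I.rho s.picks p.1 p.2 ^ 2 /
        (max (I.ε / I.κ) ((max (s.gap I w p.1) (s.gap I w p.2) + I.ε / I.κ) / 3)) ^ 2)
      (Set.finite_range _).bddAbove (i, j)
  have hζβ : ζ ^ 2 ≤ s.C I ^ 2 * matNorm s.A⁻¹ (I.direction s.picks j i) ^ 2 := by
    rw [← mul_pow]
    exact pow_le_pow_left₀ hζ0.le hlt.le 2
  have hP : 0 ≤ I.pstar s.picks i j q.1 q.2 * I.rho s.picks i j ^ 2 :=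
    mul_nonneg (I.pstar_nonneg _ _ _ _ _) (sq_nonneg _)
  have hG0 : 0 ≤ G := (sq_nonneg _).trans hG
  -- Since `ζ` is below the width, `T ζ²` is at most `C_t²` times the product that the arm selection
  -- rule controls.
  have key : (s.T q.1 q.2 : ℝ)
      ≤ G * (I.pstar s.picks i j q.1 q.2 * I.rho s.picks i j ^ 2 / ζ ^ 2) := by
    rw [← mul_div_assoc, le_div_iff₀ (by positivity)]
    calc (s.T q.1 q.2 : ℝ) * ζ ^ 2
        ≤ s.T q.1 q.2 * (s.C I ^ 2 * matNorm s.A⁻¹ (I.direction s.picks j i) ^ 2) :=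
          mul_le_mul_of_nonneg_left hζβ (Nat.cast_nonneg _)
      _ = s.C I ^ 2 * (s.T q.1 q.2 * matNorm s.A⁻¹ (I.direction s.picks j i) ^ 2) := by ring
      _ ≤ s.C I ^ 2 * (I.pstar s.picks i j q.1 q.2 * I.rho s.picks i j ^ 2) :=
          mul_le_mul_of_nonneg_left hT (sq_nonneg _)
      _ ≤ _ := mul_le_mul_of_nonneg_right hG hP
  exact key.trans (mul_le_mul_of_nonneg_left hH hG0)

lemma T_cons (s : LGState n d) (q q' : ℕ × Fin n) (w : Fin d → ℝ) (noise : ℕ → ℝ) :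
    (s.sample I w noise q).T q'.1 q'.2 = s.T q'.1 q'.2 + if q = q' then 1 else 0 := by
  simp only [T, sample, List.count_cons, beq_iff_eq]

/-- Bounds for the single arms give a bound for the total number of samples. -/
lemma length_pulls_le_of_T_le (hs : s.WellFormed I) (hs₀ : s₀.WellFormed I)
    (h : s.picks = s₀.picks)
    (hT : ∀ q ∈ s.arms, (s.T q.1 q.2 : ℝ) ≤ max (s₀.T q.1 q.2 : ℝ) (G * s₀.H I w q.1 q.2 + 1))
    (hG : 0 ≤ G) :
    (s.pulls.length : ℝ) ≤ s₀.Ntot + n * ((s₀.picks.length : ℝ) + 1) + G * s₀.Htot I w := by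
  rw [hs.length_pulls, hs₀.Ntot_eq, hs₀.length_pulls, Htot_eq, Finset.mul_sum]
  -- The `+ 1` allowed to each arm adds up to the number of available arms.
  have hcard : (n : ℝ) * ((s₀.picks.length : ℝ) + 1) = ∑ q ∈ s₀.arms, 1 := by
    simp [arms, mul_comm]
  rw [hcard]
  push_cast
  rw [← Finset.sum_add_distrib, ← Finset.sum_add_distrib, arms_congr h]
  rw [arms_congr h] at hT
  refine Finset.sum_le_sum fun q hq => (hT q hq).trans (max_le ?_ ?_)
  · have := mul_nonneg hG (s₀.H_nonneg (I := I) (w := w) q)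
    linarith
  · have : (0 : ℝ) ≤ s₀.T q.1 q.2 := Nat.cast_nonneg _
    linarith

/-- If `G` bounds the squared confidence parameter as long as not too many samples have been
taken, then the round ends, and the numbers of samples are bounded in terms of `G`. -/
lemma exists_stops (hI : I.IsAdmissible) (hn : 0 < n) (hε : 0 < I.ε) (hlam : 0 < I.lam)
    (hc : ∀ k, (run I w noise k).Confident I w) {k₀ : ℕ}
    (hs₀ : run I w noise k₀ = s₀) (hh : ¬ s₀.Halted I) (hG : 0 ≤ G)
    (hCG : ∀ k, ((run I w noise k).pulls.length : ℝ)
        ≤ s₀.Ntot + n * ((s₀.picks.length : ℝ) + 1) + G * s₀.Htot I w →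
      (run I w noise k).C I ^ 2 ≤ G) :
    ∃ k ≥ k₀, (run I w noise k).picks = s₀.picks ∧ (run I w noise k).Stops I ∧
      ∀ q ∈ s₀.arms, ((run I w noise k).T q.1 q.2 : ℝ)
        ≤ max (s₀.T q.1 q.2 : ℝ) (G * s₀.H I w q.1 q.2 + 1) := by
  have hwf : ∀ k, (run I w noise k).WellFormed I := wellFormed_run hI hn hε
  have hwf₀ : s₀.WellFormed I := hs₀ ▸ hwf k₀
  -- Until the first stop each step takes exactly one sample, so steps and samples of the round can
  -- be identified.
  have inv : ∀ m, (∀ m' < m, ¬ (run I w noise (k₀ + m')).Stops I) →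
      (run I w noise (k₀ + m)).picks = s₀.picks ∧
      (run I w noise (k₀ + m)).pulls.length = s₀.pulls.length + m ∧
      ∀ q ∈ s₀.arms, ((run I w noise (k₀ + m)).T q.1 q.2 : ℝ)
        ≤ max (s₀.T q.1 q.2 : ℝ) (G * s₀.H I w q.1 q.2 + 1) := by
    intro m
    induction m with
    | zero =>
      intro _
      rw [add_zero, hs₀]
      exact ⟨rfl, rfl, fun q _ => le_max_left _ _⟩
    | succ m ih =>
      intro hns
      obtain ⟨hp, hlen, hT⟩ := ih fun m' hm' => hns m' (hm'.trans (Nat.lt_succ_self m))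
      have hend := hns m (Nat.lt_succ_self m)
      rw [← add_assoc, run_succ]
      set s := run I w noise (k₀ + m) with hs
      have hws : s.WellFormed I := hwf _
      have hhs : ¬ s.Halted I := by rwa [Halted, hp]
      obtain ⟨q, hpk, hpl, hTq, hbound⟩ : ∃ q : ℕ × Fin n,
          (step I w noise s).picks = s.picks ∧ (step I w noise s).pulls = q :: s.pulls ∧
          (∀ q' : ℕ × Fin n, (step I w noise s).T q'.1 q'.2
            = s.T q'.1 q'.2 + if q = q' then 1 else 0) ∧
          (s.T q.1 q.2 : ℝ) ≤ G * s₀.H I w q.1 q.2 := by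
        rcases hws.swept_le.lt_or_eq with h2 | h2
        · rw [step_of_sweep hhs h2]
          refine ⟨(s.picks.length, ⟨s.swept, h2⟩), rfl, rfl, fun q' => T_cons (I := I) _ _ _ w noise, ?_⟩
          -- An arm met in the sweep is new, so its count is zero and the bound needs only `G ≥ 0`.
          have h0 : s.T s.picks.length ⟨s.swept, h2⟩ = 0 := by
            rw [T, List.count_eq_zero, hws.mem_pulls]
            simp
          rw [h0, Nat.cast_zero]
          exact mul_nonneg hG (s₀.H_nonneg _)
        · rw [step_of_sample hhs h2 hend]
          refine ⟨s.armSel I, rfl, rfl, fun q' => T_cons (I := I) _ _ _ w noise, ?_⟩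
          rw [← H_congr hp]
          -- The circle closes here: the bounds on all counts so far limit the total, so `C_t² ≤ G`,
          -- so the arm about to be sampled has count at most `G H`, and at most `G H + 1`
          -- afterwards.
          refine T_armSel_le hws (hc _) hI hn hε hlam hhs h2 hend (hCG _ ?_)
          exact length_pulls_le_of_T_le hws hwf₀ hp (by rwa [arms_congr hp]) hG
      refine ⟨hpk.trans hp, by rw [hpl, List.length_cons, hlen, add_assoc], fun q' hq' => ?_⟩
      rw [hTq]
      split_ifs with heq
      · subst heq
        push_cast
        exact le_max_of_le_right (by linarith)
      · exact hT q' hq'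
  -- Otherwise the total would grow by one at every step while remaining below a fixed bound.
  have hex : ∃ m, (run I w noise (k₀ + m)).Stops I := by
    by_contra hcon
    push Not at hcon
    obtain ⟨m, hm⟩ := exists_nat_gt
      ((s₀.Ntot : ℝ) + n * ((s₀.picks.length : ℝ) + 1) + G * s₀.Htot I w)
    obtain ⟨hp, hlen, hT⟩ := inv m fun m' _ => hcon m'
    have := length_pulls_le_of_T_le (hwf _) hwf₀ hp (by rwa [arms_congr hp]) hG
    rw [hlen] at this
    push_cast at this
    have h0 : (0 : ℝ) ≤ s₀.pulls.length := Nat.cast_nonneg _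
    linarith
  classical
  obtain ⟨hp, -, hT⟩ := inv (Nat.find hex) fun m' hm' => Nat.find_min hex hm'
  exact ⟨k₀ + Nat.find hex, Nat.le_add_right _ _, hp, Nat.find_spec hex, hT⟩

/-! ### The size of the confidence parameter -/

/-- The additive form of the logarithm is the one that both the determinant bound and the logarithm
of the potential produce. -/
lemma C_eq (hs : s.WellFormed I) (hδ : 0 < I.δ) (hlam : 0 < I.lam) :
    s.C I = I.R * √(2 * Real.log (1 / I.δ) + (Real.log s.A.det - d * Real.log I.lam))
      + √I.lam * I.W := by
  have hdet := (hs.posDef hlam).det_pos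
  have hl : 0 < I.lam ^ d := pow_pos hlam d
  rw [C, ← Real.sqrt_eq_rpow I.lam, det_smul, det_one, mul_one, Fintype.card_fin,
    div_eq_mul_one_div, Real.log_mul (by positivity) (by positivity),
    Real.log_mul (by positivity) (by positivity), Real.log_rpow hdet, Real.log_rpow hl,
    Real.log_pow]
  congr 3
  ring

/-- The determinant is at most the `d`-th power of the mean eigenvalue, and each sample raises the
trace by at most `L²`. -/
lemma log_det_le (hs : s.WellFormed I) (hlam : 0 < I.lam)
    (hL : ∀ p l a, I.feature p l a ⬝ᵥ I.feature p l a ≤ L ^ 2) :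
    Real.log s.A.det - d * Real.log I.lam
      ≤ d * Real.log (1 + s.pulls.length * L ^ 2 / (I.lam * d)) := by
  have hA := hs.posDef hlam
  rcases Nat.eq_zero_or_pos d with rfl | hd
  · simp
  have hd' : (0 : ℝ) < d := by exact_mod_cast hd
  have h1 := det_le_trace_div_pow hd hA.posSemidef
  have h2 : s.A.trace / d ≤ I.lam * (1 + s.pulls.length * L ^ 2 / (I.lam * d)) := by
    rw [div_le_iff₀ hd']
    refine (hs.trace_A_le hL).trans (le_of_eq ?_)
    field_simp
  have h3 : 0 ≤ s.A.trace / d := div_nonneg hA.posSemidef.trace_nonneg hd'.le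
  have h4 := Real.log_le_log hA.det_pos (h1.trans (pow_le_pow_left₀ h3 h2 d))
  rw [Real.log_pow, Real.log_mul (by positivity) (by positivity)] at h4
  linarith

/-- `(a + b)² ≤ 2a² + 2b²` separates the noise term from the regularisation term. -/
lemma C_sq_le (hs : s.WellFormed I) (hδ : 0 < I.δ) (hδ' : I.δ < 1) (hlam : 0 < I.lam)
    (hL : ∀ p l a, I.feature p l a ⬝ᵥ I.feature p l a ≤ L ^ 2) :
    s.C I ^ 2 ≤ 2 * I.R ^ 2 * (2 * Real.log (1 / I.δ)
        + d * Real.log (1 + s.pulls.length * L ^ 2 / (I.lam * d))) + 2 * (I.lam * I.W ^ 2) := by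
  have hlog : 0 < Real.log (1 / I.δ) := Real.log_pos (by rw [lt_div_iff₀ hδ]; linarith)
  have hlogX : 0 ≤ Real.log (1 + s.pulls.length * L ^ 2 / (I.lam * d)) :=
    Real.log_nonneg (by
      have : 0 ≤ s.pulls.length * L ^ 2 / (I.lam * d) := by positivity
      linarith)
  set Y := 2 * Real.log (1 / I.δ) + d * Real.log (1 + s.pulls.length * L ^ 2 / (I.lam * d))
    with hY
  have hY0 : 0 ≤ Y := by positivity
  have h1 : √(2 * Real.log (1 / I.δ) + (Real.log s.A.det - d * Real.log I.lam)) ^ 2 ≤ Y := by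
    rw [← Real.sq_sqrt hY0]
    refine pow_le_pow_left₀ (Real.sqrt_nonneg _) (Real.sqrt_le_sqrt ?_) 2
    have := log_det_le hs hlam hL
    rw [hY]
    linarith
  rw [C_eq hs hδ hlam]
  set y := √(2 * Real.log (1 / I.δ) + (Real.log s.A.det - d * Real.log I.lam))
  have h2 : √I.lam ^ 2 = I.lam := Real.sq_sqrt hlam.le
  have h3 : (I.R * y + √I.lam * I.W) ^ 2
      ≤ 2 * ((I.R : ℝ) ^ 2 * y ^ 2) + 2 * (√I.lam ^ 2 * I.W ^ 2) := by
    nlinarith [sq_nonneg (I.R * y - √I.lam * I.W)]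
  rw [h2] at h3
  have h4 := mul_le_mul_of_nonneg_left h1 (sq_nonneg (I.R : ℝ))
  linarith

/-- A square root grows more slowly than a linear function. With `Y = A + BK + B + 1` and `G = K +
Y`, the radicand is `A + BK + BY ≤ Y²`. -/
lemma exists_nonneg_add_sqrt_le {A B K : ℝ} (hA : 0 ≤ A) (hB : 0 ≤ B) (hK : 0 ≤ K) :
    ∃ G, 0 ≤ G ∧ K + √(A + B * G) ≤ G := by
  refine ⟨K + (A + B * K + B + 1), by positivity, ?_⟩
  gcongr
  refine Real.sqrt_le_iff.mpr ⟨by positivity, ?_⟩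
  have := mul_nonneg hB hK
  nlinarith [mul_nonneg hA hB, mul_nonneg hA this, mul_nonneg hB this, sq_nonneg (A + B * K)]

/-- The hypothesis of `exists_stops` can always be met. -/
lemma exists_bound (hδ : 0 < I.δ) (hδ' : I.δ < 1) (hlam : 0 < I.lam)
    (hL : ∀ p l a, I.feature p l a ⬝ᵥ I.feature p l a ≤ L ^ 2) {N h : ℝ} (hN : 0 ≤ N)
    (hh : 0 ≤ h) :
    ∃ G, 0 ≤ G ∧ ∀ s : LGState n d, s.WellFormed I → (s.pulls.length : ℝ) ≤ N + G * h →
      s.C I ^ 2 ≤ G := by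
  have hlog : 0 < Real.log (1 / I.δ) := Real.log_pos (by rw [lt_div_iff₀ hδ]; linarith)
  set e := L ^ 2 / (I.lam * d) with he
  have he0 : 0 ≤ e := by positivity
  -- From `log X ≤ 2√X` the bound for `C²` becomes `K + 4R²d √(1 + (N + Gh)e)`; `A` and `B` arise by
  -- moving the factor `4R²d` under the root.
  obtain ⟨G, hG0, hG⟩ := exists_nonneg_add_sqrt_le (A := (4 * I.R ^ 2 * d) ^ 2 * (1 + N * e))
    (B := (4 * I.R ^ 2 * d) ^ 2 * (h * e))
    (K := 4 * I.R ^ 2 * Real.log (1 / I.δ) + 2 * (I.lam * I.W ^ 2))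
    (by positivity) (by positivity) (by positivity)
  refine ⟨G, hG0, fun s hs hlen => (C_sq_le hs hδ hδ' hlam hL).trans (le_trans ?_ hG)⟩
  have hX0 : 0 ≤ 1 + s.pulls.length * L ^ 2 / (I.lam * d) := by positivity
  have h1 : Real.log (1 + s.pulls.length * L ^ 2 / (I.lam * d))
      ≤ 2 * √(1 + (N + G * h) * e) := by
    have h2 := Real.log_le_sub_one_of_pos
      (Real.sqrt_pos.mpr (by positivity : 0 < 1 + s.pulls.length * L ^ 2 / (I.lam * d)))
    rw [Real.log_sqrt hX0] at h2
    have h3 : √(1 + s.pulls.length * L ^ 2 / (I.lam * d)) ≤ √(1 + (N + G * h) * e) := by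
      apply Real.sqrt_le_sqrt
      rw [mul_div_assoc]
      gcongr
    linarith
  have h4 : √((4 * I.R ^ 2 * d) ^ 2 * (1 + N * e) + (4 * I.R ^ 2 * d) ^ 2 * (h * e) * G)
      = 4 * I.R ^ 2 * d * √(1 + (N + G * h) * e) := by
    rw [← Real.sqrt_sq (by positivity : (0 : ℝ) ≤ 4 * I.R ^ 2 * d),
      ← Real.sqrt_mul (by positivity), Real.sqrt_sq (by positivity : (0 : ℝ) ≤ 4 * I.R ^ 2 * d)]
    congr 1
    ring
  rw [h4]
  have h5 := mul_le_mul_of_nonneg_left h1 (by positivity : (0 : ℝ) ≤ 2 * I.R ^ 2 * d)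
  linarith

/-- Resolves the self-reference in the sample bound: a count bounded through `log m` has determinant
growth at most `m²`, whose logarithm is again `2 log m`. -/
lemma one_add_le_sq_of_le {t N h r l x m : ℝ} {d : ℕ} (hd : 0 < d) (hN : 0 ≤ N) (hh : 0 ≤ h)
    (hr : 0 ≤ r) (hl : 0 ≤ l) (hx : 0 ≤ x)
    (hm : m = 16 * (h * r * x) * l + 32 * (h * r * x) ^ 2 + 2 * (N * (x / d)) + 2)
    (ht : t ≤ N + 4 * r * (2 * l + d * Real.log m) * h) :
    1 + t * (x / d) ≤ m ^ 2 := by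
  have hd' : (1 : ℝ) ≤ d := by exact_mod_cast hd
  set c := h * r * x with hc
  have hc0 : 0 ≤ c := by positivity
  have hNx : 0 ≤ N * (x / d) := by positivity
  have hcl : 0 ≤ c * l := by positivity
  have hm2 : 2 ≤ m := by
    rw [hm]
    nlinarith [sq_nonneg c]
  have hy0 : 0 < √m := Real.sqrt_pos.mpr (by linarith)
  have hy2 : √m ^ 2 = m := Real.sq_sqrt (by linarith)
  have hlog : Real.log m ≤ 2 * √m := by
    have := Real.log_le_sub_one_of_pos hy0
    rw [Real.log_sqrt (by linarith)] at this
    linarith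
  have h1 : t * (x / d) ≤ (N + 4 * r * (2 * l + d * Real.log m) * h) * (x / d) :=
    mul_le_mul_of_nonneg_right ht (by positivity)
  have h2 : (N + 4 * r * (2 * l + d * Real.log m) * h) * (x / d)
      = N * (x / d) + 8 * (c * l) / d + 4 * c * Real.log m := by
    rw [hc]
    field_simp
    ring
  have h3 : 8 * (c * l) / d ≤ 8 * (c * l) := div_le_self (by positivity) hd'
  have h4 : 4 * c * Real.log m ≤ 4 * c * (2 * √m) := mul_le_mul_of_nonneg_left hlog (by positivity)
  -- The square gives `8c√m ≤ 16c² + m`. The remaining terms `1 + N(x/d) + 8cl + 16c²` are exactly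
  -- `m/2`, so the total is at most `3m/2 ≤ m²`, as `m ≥ 2`.
  nlinarith [sq_nonneg (4 * c - √m)]

/-- The explicit choice that meets the hypothesis of `exists_stops`. -/
lemma C_sq_le_of_length_le (hs : s.WellFormed I) (hδ : 0 < I.δ) (hδ' : I.δ < 1)
    (hlam : 0 < I.lam) (hL : ∀ p l a, I.feature p l a ⬝ᵥ I.feature p l a ≤ L ^ 2)
    (hW : I.lam * I.W ^ 2 ≤ 2 * I.R ^ 2 * Real.log (1 / I.δ))
    (hlen : (s.pulls.length : ℝ) ≤ s₀.Ntot + n * ((s₀.picks.length : ℝ) + 1)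
      + 4 * I.R ^ 2 * (2 * Real.log (1 / I.δ) + d * Real.log (s₀.M I w L)) * s₀.Htot I w) :
    s.C I ^ 2 ≤ 4 * I.R ^ 2 * (2 * Real.log (1 / I.δ) + d * Real.log (s₀.M I w L)) := by
  have hlog : 0 < Real.log (1 / I.δ) := Real.log_pos (by rw [lt_div_iff₀ hδ]; linarith)
  refine (C_sq_le hs hδ hδ' hlam hL).trans ?_
  -- Doubling `log M` turns the leading `2R²` into `4R²`; the hypothesis `hW` lets the
  -- regularisation term supply the matching increase of the `log (1/δ)` part.
  have key : d * Real.log (1 + s.pulls.length * L ^ 2 / (I.lam * d))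
      ≤ 2 * (d * Real.log (s₀.M I w L)) := by
    rcases Nat.eq_zero_or_pos d with rfl | hd
    · simp
    have h := one_add_le_sq_of_le (x := L ^ 2 / I.lam) (m := s₀.M I w L) hd
      (by positivity : (0 : ℝ) ≤ s₀.Ntot + n * ((s₀.picks.length : ℝ) + 1))
      (s₀.Htot_nonneg (I := I) (w := w)) (sq_nonneg (I.R : ℝ)) hlog.le (by positivity)
      (by rw [M]; ring) hlen
    rw [div_div, ← mul_div_assoc] at h
    have h2 := Real.log_le_log (by positivity) h
    rw [Real.log_pow] at h2
    push_cast at h2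
    have hd' : (0 : ℝ) ≤ d := Nat.cast_nonneg _
    nlinarith
  have := mul_le_mul_of_nonneg_left key (by positivity : (0 : ℝ) ≤ 2 * I.R ^ 2)
  linarith

/-- Arm by arm, the increase of the count is either zero or at most `G H + 1` minus the earlier
count, whence the maximum with zero. -/
lemma sub_length_le_sampleBound (hs : s.WellFormed I) (hs₀ : s₀.WellFormed I)
    (hp : s.picks = s₀.picks)
    (hG : G = 4 * I.R ^ 2 * (2 * Real.log (1 / I.δ) + d * Real.log (s₀.M I w L)))
    (hT : ∀ q ∈ s₀.arms, (s.T q.1 q.2 : ℝ)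
      ≤ max (s₀.T q.1 q.2 : ℝ) (G * s₀.H I w q.1 q.2 + 1)) :
    (s.pulls.length : ℝ) - s₀.pulls.length ≤ s₀.sampleBound I w L := by
  rw [sampleBound, sum_arms s₀ fun l a => max (4 * s₀.H I w l a * I.R ^ 2
    * (2 * Real.log (1 / I.δ) + d * Real.log (s₀.M I w L)) + 1 - s₀.T l a) 0,
    hs.length_pulls, hs₀.length_pulls, arms_congr hp]
  push_cast
  rw [← Finset.sum_sub_distrib]
  refine Finset.sum_le_sum fun q hq => ?_
  have h := hT q hq
  have e : 4 * s₀.H I w q.1 q.2 * I.R ^ 2 * (2 * Real.log (1 / I.δ)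
      + d * Real.log (s₀.M I w L)) = G * s₀.H I w q.1 q.2 := by
    rw [hG]
    ring
  rw [e]
  rcases le_max_iff.mp h with h | h
  · exact le_max_of_le_right (by linarith)
  · exact le_max_of_le_left (by linarith)

end LGState

/-! ### Measurability of the run -/

section Measurability

/-- Lists over a countable type carry the discrete measurable structure. -/
instance List.measurableSpaceTop {α : Type*} : MeasurableSpace (List α) := ⊤

instance List.discreteMeasurableSpaceTop {α : Type*} : DiscreteMeasurableSpace (List α) :=
  ⟨fun _ => MeasurableSpace.measurableSet_top⟩

instance Matrix.measurableSpacePi {m n : Type*} : MeasurableSpace (Matrix m n ℝ) :=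
  inferInstanceAs (MeasurableSpace (m → n → ℝ))

instance Matrix.borelSpacePi {d : ℕ} : BorelSpace (Matrix (Fin d) (Fin d) ℝ) :=
  inferInstanceAs (BorelSpace (Fin d → Fin d → ℝ))

variable {α : Type*} [MeasurableSpace α] {n d : ℕ}

lemma measurable_argmaxSet {g : α → Fin n → ℝ} (hg : ∀ i, Measurable fun a => g a i) :
    Measurable fun a => argmaxSet (g a) := by
  rw [measurable_finset_iff]
  intro i
  simp only [mem_argmaxSet]
  refine measurableSet_setOfPred.mp ?_
  simp only [Set.ofPred_forall]
  exact MeasurableSet.iInter fun j => measurableSet_le (hg j) (hg i)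

lemma Measurable.matrix_det' {A : α → Matrix (Fin d) (Fin d) ℝ} (hA : Measurable A) :
    Measurable fun a => (A a).det :=
  (continuous_id.matrix_det.measurable).comp hA

lemma Measurable.matrix_inv {A : α → Matrix (Fin d) (Fin d) ℝ} (hA : Measurable A) :
    Measurable fun a => (A a)⁻¹ := by
  simp only [Matrix.inv_def, Ring.inverse_eq_inv']
  have h : Measurable fun a => (A a).adjugate := (continuous_id.matrix_adjugate.measurable).comp hA
  refine measurable_pi_lambda _ fun i => measurable_pi_lambda _ fun j => ?_
  have h1 : Measurable fun a => (A a).adjugate i j :=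
    (measurable_pi_apply j).comp ((measurable_pi_apply i).comp h)
  exact hA.matrix_det'.inv.mul h1

lemma Measurable.dotProduct_vec {x y : α → Fin d → ℝ} (hx : Measurable x) (hy : Measurable y) :
    Measurable fun a => x a ⬝ᵥ y a := by
  simp only [dotProduct]
  fun_prop

lemma Measurable.mulVec_vec {A : α → Matrix (Fin d) (Fin d) ℝ} {x : α → Fin d → ℝ}
    (hA : Measurable A) (hx : Measurable x) : Measurable fun a => A a *ᵥ x a :=
  measurable_pi_lambda _ fun i => ((measurable_pi_apply i).comp hA).dotProduct_vec hx

lemma Measurable.matNorm {A : α → Matrix (Fin d) (Fin d) ℝ} {x : α → Fin d → ℝ}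
    (hA : Measurable A) (hx : Measurable x) : Measurable fun a => matNorm (A a) (x a) :=
  (hx.dotProduct_vec (hA.mulVec_vec hx)).sqrt

/-! ### Measurability of the state, of one step and of the run -/

namespace LGState

instance : MeasurableSpace (LGState n d) :=
  MeasurableSpace.comap
    (fun s => ((s.picks, s.swept, s.pulls), (s.A, s.b))) inferInstance

lemma measurable_tuple : Measurable fun s : LGState n d =>
    ((s.picks, s.swept, s.pulls), (s.A, s.b)) :=
  comap_measurable _

lemma measurable_picks : Measurable fun s : LGState n d => s.picks := measurable_tuple.fst.fst

lemma measurable_swept : Measurable fun s : LGState n d => s.swept :=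
  measurable_tuple.fst.snd.fst

lemma measurable_pulls : Measurable fun s : LGState n d => s.pulls :=
  measurable_tuple.fst.snd.snd

lemma measurable_A : Measurable fun s : LGState n d => s.A := measurable_tuple.snd.fst

lemma measurable_b : Measurable fun s : LGState n d => s.b := measurable_tuple.snd.snd

lemma measurable_of_fields {s : α → LGState n d} (h1 : Measurable fun a => (s a).picks)
    (h2 : Measurable fun a => (s a).swept) (h3 : Measurable fun a => (s a).pulls)
    (h4 : Measurable fun a => (s a).A) (h5 : Measurable fun a => (s a).b) : Measurable s :=
  measurable_comap_iff.mpr ((h1.prodMk (h2.prodMk h3)).prodMk (h4.prodMk h5))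

variable (I : LGInput n d) (w : Fin d → ℝ)

lemma measurable_what : Measurable fun s : LGState n d => s.what :=
  measurable_A.matrix_inv.mulVec_vec measurable_b

lemma measurable_C : Measurable fun s : LGState n d => s.C I := by
  unfold C
  have := (measurable_A (n := n) (d := d)).matrix_det'
  fun_prop

lemma measurable_marginal_dotProduct (i : Fin n) :
    Measurable fun s : LGState n d => marginal I.F s.sol i ⬝ᵥ s.what :=
  ((Measurable.of_discrete (f := fun p : List (Fin n) => marginal I.F p.toFinset i)).comp
    measurable_picks).dotProduct_vec measurable_what

lemma measurable_iSel : Measurable fun s : LGState n d => s.iSel I :=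
  (Measurable.of_discrete (f := fun p : List (ℕ × Fin n) × Finset (Fin n) => I.tieI p.1 p.2)).comp
    (measurable_pulls.prodMk (measurable_argmaxSet (measurable_marginal_dotProduct I)))

lemma measurable_apply_index {g : α → Fin n → ℝ} (hg : ∀ i, Measurable fun a => g a i)
    {i : α → Fin n} (hi : Measurable i) : Measurable fun a => g a (i a) :=
  (measurable_from_prod_countable_left (f := fun p : α × Fin n => g p.1 p.2) hg).comp
    (measurable_id.prodMk hi)

lemma measurable_ucb (j : Fin n) : Measurable fun s : LGState n d => s.ucb I j := by
  unfold ucb beta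
  refine ((measurable_marginal_dotProduct I j).sub (measurable_apply_index
    (measurable_marginal_dotProduct I) (measurable_iSel I))).add
    ((measurable_C I).mul (measurable_A.matrix_inv.matNorm ?_))
  exact (Measurable.of_discrete (f := fun p : List (Fin n) × Fin n => I.direction p.1 j p.2)).comp
    (measurable_picks.prodMk (measurable_iSel I))

lemma measurable_jSel : Measurable fun s : LGState n d => s.jSel I :=
  (Measurable.of_discrete (f := fun p : List (ℕ × Fin n) × Finset (Fin n) => I.tieJ p.1 p.2)).comp
    (measurable_pulls.prodMk (measurable_argmaxSet (measurable_ucb I)))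

lemma measurable_B : Measurable fun s : LGState n d => s.B I :=
  measurable_apply_index (measurable_ucb I) (measurable_jSel I)

-- The choice reads only the picks, the pulls and the pair `(i_t, j_t)`, all discrete, so every
-- function of them is measurable.
open Classical in
lemma measurable_armSel : Measurable fun s : LGState n d => s.armSel I :=
  (Measurable.of_discrete (f := fun t : (List (Fin n) × List (ℕ × Fin n)) × (Fin n × Fin n) =>
      I.tieArm t.1.2
        (let p : ℕ × Fin n → ℝ := fun q => I.pstar t.1.1 t.2.1 t.2.2 q.1 q.2
        let supp := (Finset.range (t.1.1.length + 1) ×ˢ (Finset.univ : Finset (Fin n))).filter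
          fun q => 0 < p q
        supp.filter fun q => ∀ q' ∈ supp,
          (t.1.2.count (q.1, q.2) : ℝ) / p q ≤ (t.1.2.count (q'.1, q'.2) : ℝ) / p q'))).comp
    ((measurable_picks.prodMk measurable_pulls).prodMk
      ((measurable_iSel I).prodMk (measurable_jSel I)))

lemma measurable_sample {s : α → LGState n d} {q : α → ℕ × Fin n} {z : α → ℝ}
    (hs : Measurable s) (hq : Measurable q) (hz : Measurable z) :
    Measurable fun a => (s a).sample I w (fun _ => z a) (q a) := by
  have hx : Measurable fun a => I.feature (s a).picks (q a).1 (q a).2 :=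
    (Measurable.of_discrete
      (f := fun p : List (Fin n) × (ℕ × Fin n) => I.feature p.1 p.2.1 p.2.2)).comp
      ((measurable_picks.comp hs).prodMk hq)
  have h1 : Measurable fun a => (s a).picks := measurable_picks.comp hs
  have h2 : Measurable fun a => (s a).swept := measurable_swept.comp hs
  refine measurable_of_fields h1 h2 ?_ ?_ ?_
  · exact (Measurable.of_discrete
      (f := fun p : (ℕ × Fin n) × List (ℕ × Fin n) => p.1 :: p.2)).comp
      (hq.prodMk (measurable_pulls.comp hs))
  · refine measurable_pi_lambda _ fun i => measurable_pi_lambda _ fun j => ?_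
    have h1 : Measurable fun a => (s a).A i j :=
      (measurable_pi_apply j).comp ((measurable_pi_apply i).comp (measurable_A.comp hs))
    exact h1.add (((measurable_pi_apply i).comp hx).mul ((measurable_pi_apply j).comp hx))
  · refine measurable_pi_lambda _ fun i => ?_
    exact ((measurable_pi_apply i).comp (measurable_b.comp hs)).add
      (((hx.dotProduct_vec measurable_const).add hz).mul ((measurable_pi_apply i).comp hx))

lemma measurable_step :
    Measurable fun p : LGState n d × ℝ => step I w (fun _ => p.2) p.1 := by
  have hH : MeasurableSet {p : LGState n d × ℝ | p.1.Halted I} :=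
    (measurable_picks.comp measurable_fst)
      (MeasurableSet.of_discrete (s := {l : List (Fin n) | l.length = I.κ}))
  have hS : MeasurableSet {p : LGState n d × ℝ | p.1.swept < n} :=
    (measurable_swept.comp measurable_fst) (MeasurableSet.of_discrete (s := {m : ℕ | m < n}))
  have hB : MeasurableSet {p : LGState n d × ℝ | p.1.B I ≤ I.ε / I.κ} :=
    measurableSet_le ((measurable_B I).comp measurable_fst) measurable_const
  classical
  have hpulls : Measurable fun p : LGState n d × ℝ => p.1.pulls :=
    measurable_pulls.comp measurable_fst
  have hA : Measurable fun p : LGState n d × ℝ => p.1.A := measurable_A.comp measurable_fst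
  have hb : Measurable fun p : LGState n d × ℝ => p.1.b := measurable_b.comp measurable_fst
  have hnext : Measurable fun p : LGState n d × ℝ => p.1.nextRound I :=
    measurable_of_fields
      ((Measurable.of_discrete (f := fun p : List (Fin n) × Fin n => p.1 ++ [p.2])).comp
        ((measurable_picks.comp measurable_fst).prodMk ((measurable_iSel I).comp measurable_fst)))
      measurable_const hpulls hA hb
  have hsam : Measurable fun p : LGState n d × ℝ =>
      p.1.sample I w (fun _ => p.2) (p.1.armSel I) :=
    measurable_sample I w measurable_fst ((measurable_armSel I).comp measurable_fst)
      measurable_snd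
  -- The index of the swept arm is made total by a dummy element of `Fin n`. For `n = 0` there is
  -- none, but then the sweep branch is void.
  rcases Nat.eq_zero_or_pos n with hn | hn
  · have : (fun p : LGState n d × ℝ => step I w (fun _ => p.2) p.1) = fun p =>
        if p.1.Halted I then p.1 else if p.1.B I ≤ I.ε / I.κ then p.1.nextRound I
          else p.1.sample I w (fun _ => p.2) (p.1.armSel I) := by
      funext p
      rw [step]
      split_ifs <;> first | rfl | omega
    rw [this]
    exact Measurable.ite hH measurable_fst (Measurable.ite hB hnext hsam)
  · set sw : LGState n d × ℝ → ℕ × Fin n := fun p =>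
      (p.1.picks.length, if h : p.1.swept < n then ⟨p.1.swept, h⟩ else ⟨0, hn⟩) with hsw_def
    have hsw : Measurable sw :=
      (Measurable.of_discrete (f := fun t : List (Fin n) × ℕ =>
        ((t.1.length, if h : t.2 < n then ⟨t.2, h⟩ else ⟨0, hn⟩) : ℕ × Fin n))).comp
        ((measurable_picks.comp measurable_fst).prodMk (measurable_swept.comp measurable_fst))
    have hs0 := measurable_sample I w measurable_fst hsw measurable_snd
    have h3 : Measurable fun p : LGState n d × ℝ => (p.1.sample I w (fun _ => p.2) (sw p)).pulls :=
      measurable_pulls.comp hs0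
    have h4 : Measurable fun p : LGState n d × ℝ => (p.1.sample I w (fun _ => p.2) (sw p)).A :=
      measurable_A.comp hs0
    have h5 : Measurable fun p : LGState n d × ℝ => (p.1.sample I w (fun _ => p.2) (sw p)).b :=
      measurable_b.comp hs0
    have hp1 : Measurable fun p : LGState n d × ℝ => p.1.picks :=
      measurable_picks.comp measurable_fst
    have hswp : Measurable fun p : LGState n d × ℝ =>
        { p.1.sample I w (fun _ => p.2) (sw p) with swept := p.1.swept + 1 } :=
      measurable_of_fields hp1
        ((measurable_swept.comp measurable_fst).add_const 1) h3 h4 h5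
    have : (fun p : LGState n d × ℝ => step I w (fun _ => p.2) p.1) = fun p =>
        if p.1.Halted I then p.1 else if p.1.swept < n then
          { p.1.sample I w (fun _ => p.2) (sw p) with swept := p.1.swept + 1 }
        else if p.1.B I ≤ I.ε / I.κ then p.1.nextRound I
          else p.1.sample I w (fun _ => p.2) (p.1.armSel I) := by
      funext p
      by_cases h1 : p.1.Halted I
      · rw [step_of_halted h1, if_pos h1]
      by_cases h2 : p.1.swept < n
      · rw [step_of_sweep h1 h2, if_neg h1, if_pos h2]
        simp only [hsw_def, dif_pos h2]
      · rw [step, if_neg h1, if_neg h1, dif_neg h2, if_neg h2]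
    rw [this]
    exact Measurable.ite hH measurable_fst
      (Measurable.ite hS hswp (Measurable.ite hB hnext hsam))

/-- A step reads a single entry of the noise, at the number of samples so far; hence measurability
and expectations of a step need only one real variable. -/
lemma step_eq_step_const (noise : ℕ → ℝ) (s : LGState n d) :
    step I w noise s = step I w (fun _ => noise s.pulls.length) s := rfl

lemma measurable_length_pulls : Measurable fun s : LGState n d => s.pulls.length :=
  (Measurable.of_discrete (f := fun l : List (ℕ × Fin n) => l.length)).comp measurable_pulls

lemma measurable_run (k : ℕ) : Measurable fun noise : ℕ → ℝ => run I w noise k := by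
  induction k with
  | zero => exact measurable_const
  | succ k ih =>
    have h : Measurable fun noise : ℕ → ℝ => noise (run I w noise k).pulls.length :=
      (measurable_from_prod_countable_left (f := fun p : (ℕ → ℝ) × ℕ => p.1 p.2)
        measurable_pi_apply).comp (measurable_id.prodMk (measurable_length_pulls.comp ih))
    have : (fun noise : ℕ → ℝ => run I w noise (k + 1)) = fun noise =>
        step I w (fun _ => noise (run I w noise k).pulls.length) (run I w noise k) := by
      funext noise
      rw [run_succ, step_eq_step_const]
    rw [this]
    exact (measurable_step I w).comp (ih.prodMk h)

end LGState

end Measurability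

/-! ### The self-normalised bound -/

section SelfNormalised

open scoped ENNReal

/-- Ville's maximal inequality, for a process that is a supermartingale as long as it stays
below the level `c`. -/
lemma mul_measure_exists_lt_le {Ω : Type*} [MeasurableSpace Ω] {μ : Measure Ω}
    {f : ℕ → Ω → ℝ≥0∞} (hf : ∀ k, Measurable (f k)) {c : ℝ≥0∞}
    (h0 : ∫⁻ ω, f 0 ω ∂μ ≤ 1)
    (hstep : ∀ k, ∫⁻ ω in {ω | ∀ j ≤ k, f j ω ≤ c}, f (k + 1) ω ∂μ
      ≤ ∫⁻ ω in {ω | ∀ j ≤ k, f j ω ≤ c}, f k ω ∂μ) :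
    c * μ {ω | ∃ k, c < f k ω} ≤ 1 := by
  have hgood : ∀ k, MeasurableSet {ω | ∀ j ≤ k, f j ω ≤ c} := fun k => by
    have : {ω | ∀ j ≤ k, f j ω ≤ c} = ⋂ j, ⋂ (_ : j ≤ k), {ω | f j ω ≤ c} := by
      ext ω
      simp
    rw [this]
    exact MeasurableSet.iInter fun j => MeasurableSet.iInter fun _ =>
      measurableSet_le (hf j) measurable_const
  have hlt : ∀ k, MeasurableSet {ω | c < f k ω} := fun k =>
    measurableSet_lt measurable_const (hf k)
  -- Markov's inequality on the part of `E` above the level, with the integral over the rest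
  -- retained.
  have hmark : ∀ k (E : Set Ω), MeasurableSet E →
      c * μ (E ∩ {ω | c < f k ω}) + ∫⁻ ω in E ∩ {ω | f k ω ≤ c}, f k ω ∂μ
        ≤ ∫⁻ ω in E, f k ω ∂μ := by
    intro k E hE
    have h1 : c * μ (E ∩ {ω | c < f k ω}) ≤ ∫⁻ ω in E ∩ {ω | c < f k ω}, f k ω ∂μ := by
      rw [← setLIntegral_const]
      exact setLIntegral_mono (hf k) fun ω hω => le_of_lt hω.2
    have h2 := lintegral_inter_add_sdiff (μ := μ) (f k) E (hlt k)
    have h3 : E \ {ω | c < f k ω} = E ∩ {ω | f k ω ≤ c} := by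
      ext ω
      simp
    rw [h3] at h2
    rw [← h2]
    gcongr
  -- The induction carries the mass that has crossed, weighted by `c`, together with the integral
  -- over the paths that have not. Stopping times are thus avoided.
  have key : ∀ k, c * μ {ω | ∃ j ≤ k, c < f j ω}
      + ∫⁻ ω in {ω | ∀ j ≤ k, f j ω ≤ c}, f k ω ∂μ ≤ 1 := by
    intro k
    induction k with
    | zero =>
      refine le_trans ?_ h0
      simpa using hmark 0 Set.univ MeasurableSet.univ
    | succ k ih =>
      have e1 : {ω | ∃ j ≤ k + 1, c < f j ω} ⊆ {ω | ∃ j ≤ k, c < f j ω}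
          ∪ ({ω | ∀ j ≤ k, f j ω ≤ c} ∩ {ω | c < f (k + 1) ω}) := by
        rintro ω ⟨j, hj, hlt⟩
        by_cases h : ∃ j ≤ k, c < f j ω
        · exact Or.inl h
        · push Not at h
          refine Or.inr ⟨h, ?_⟩
          rcases Nat.lt_or_ge k j with h' | h'
          · have : j = k + 1 := by omega
            exact this ▸ hlt
          · exact absurd hlt (not_lt.mpr (h j h'))
      have e2 : {ω | ∀ j ≤ k + 1, f j ω ≤ c}
          = {ω | ∀ j ≤ k, f j ω ≤ c} ∩ {ω | f (k + 1) ω ≤ c} := by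
        ext ω
        constructor
        · exact fun h => ⟨fun j hj => h j (hj.trans (Nat.le_succ k)), h (k + 1) le_rfl⟩
        · rintro ⟨h, h'⟩ j hj
          rcases Nat.lt_or_ge k j with h2 | h2
          · have : j = k + 1 := by omega
            exact this ▸ h'
          · exact h j h2
      calc _ ≤ c * (μ {ω | ∃ j ≤ k, c < f j ω}
              + μ ({ω | ∀ j ≤ k, f j ω ≤ c} ∩ {ω | c < f (k + 1) ω}))
            + ∫⁻ ω in {ω | ∀ j ≤ k, f j ω ≤ c} ∩ {ω | f (k + 1) ω ≤ c}, f (k + 1) ω ∂μ := by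
            rw [e2]
            gcongr
            exact (measure_mono e1).trans (measure_union_le _ _)
        _ ≤ c * μ {ω | ∃ j ≤ k, c < f j ω}
            + ∫⁻ ω in {ω | ∀ j ≤ k, f j ω ≤ c}, f (k + 1) ω ∂μ := by
            rw [mul_add, add_assoc]
            gcongr
            exact hmark (k + 1) _ (hgood k)
        _ ≤ _ := by
            exact add_le_add le_rfl (hstep k)
        _ ≤ 1 := ih
  have hmono : Monotone fun k => {ω | ∃ j ≤ k, c < f j ω} := fun k k' hk ω ⟨j, hj, h⟩ =>
    ⟨j, hj.trans hk, h⟩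
  have hU : {ω | ∃ k, c < f k ω} = ⋃ k, {ω | ∃ j ≤ k, c < f j ω} := by
    ext ω
    simp only [Set.mem_ofPred_eq, Set.mem_iUnion]
    exact ⟨fun ⟨k, hk⟩ => ⟨k, k, le_rfl, hk⟩, fun ⟨_, j, _, hj⟩ => ⟨j, hj⟩⟩
  rw [hU, hmono.measure_iUnion, ENNReal.mul_iSup]
  exact iSup_le fun k => le_self_add.trans (key k)

/-! ### The potential along the run -/

namespace LGState

variable {n d : ℕ} {I : LGInput n d} {w : Fin d → ℝ} {s : LGState n d}

variable (I w s) in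
/-- The noise-weighted sum of the sampled feature vectors. -/
noncomputable def noiseSum : Fin d → ℝ := s.b - s.A *ᵥ w + I.lam • w

variable (I w s) in
/-- The self-normalised exponential process. -/
noncomputable def potential : ℝ≥0∞ :=
  ENNReal.ofReal (√(I.lam ^ d / s.A.det)
    * Real.exp (s.noiseSum I w ⬝ᵥ (s.A⁻¹ *ᵥ s.noiseSum I w) / (2 * I.R ^ 2)))

/-- The signal part `(x·w) x` of the reward cancels against the growth of `A w`. -/
lemma noiseSum_sample (noise : ℕ → ℝ) (q : ℕ × Fin n) :
    (s.sample I w noise q).noiseSum I w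
      = s.noiseSum I w + noise s.pulls.length • I.feature s.picks q.1 q.2 := by
  simp only [noiseSum, sample, add_mulVec, vecMulVec_self_mulVec, add_smul]
  abel

/-- A step either ignores the noise and leaves the statistics unchanged, or takes one sample. -/
lemma step_cases (I : LGInput n d) (w : Fin d → ℝ) (s : LGState n d) :
    (∃ s' : LGState n d, s'.A = s.A ∧ s'.b = s.b ∧ s'.pulls = s.pulls ∧
      ∀ noise, step I w noise s = s') ∨
    ∃ q, ∀ noise, (step I w noise s).A = (s.sample I w noise q).A ∧
      (step I w noise s).b = (s.sample I w noise q).b ∧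
      (step I w noise s).pulls = q :: s.pulls := by
  by_cases h : s.Halted I
  · exact Or.inl ⟨s, rfl, rfl, rfl, fun _ => step_of_halted h⟩
  by_cases h2 : s.swept < n
  · exact Or.inr ⟨(s.picks.length, ⟨s.swept, h2⟩), fun noise => by
      rw [step_of_sweep h h2]
      exact ⟨rfl, rfl, rfl⟩⟩
  by_cases h3 : s.B I ≤ I.ε / I.κ
  · exact Or.inl ⟨s.nextRound I, rfl, rfl, rfl, fun _ => by
      rw [step, if_neg h, dif_neg h2, if_pos h3]⟩
  · exact Or.inr ⟨s.armSel I, fun noise => by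
      rw [step, if_neg h, dif_neg h2, if_neg h3]
      exact ⟨rfl, rfl, rfl⟩⟩

lemma length_pulls_le_step (noise : ℕ → ℝ) :
    s.pulls.length ≤ (step I w noise s).pulls.length := by
  rcases step_cases I w s with ⟨s', -, -, hp, h⟩ | ⟨q, h⟩
  · rw [h, hp]
  · rw [(h noise).2.2]
    exact Nat.le_succ _

lemma monotone_length_pulls (noise : ℕ → ℝ) :
    Monotone fun k => (run I w noise k).pulls.length :=
  monotone_nat_of_le_succ fun k => by
    rw [run_succ]
    exact length_pulls_le_step noise

/-- The run depends only on the noise of the samples taken. -/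
lemma run_congr {x y : ℕ → ℝ} {k : ℕ} (h : ∀ i < (run I w x k).pulls.length, x i = y i) :
    run I w y k = run I w x k := by
  induction k with
  | zero => rfl
  | succ k ih =>
    have hmono := monotone_length_pulls (I := I) (w := w) x (Nat.le_succ k)
    have ih' := ih fun i hi => h i (hi.trans_le hmono)
    rw [run_succ, run_succ, ih']
    rcases step_cases I w (run I w x k) with ⟨s', -, -, -, h'⟩ | ⟨q, h'⟩
    · rw [h', h']
    · rw [step_eq_step_const, step_eq_step_const _ _ x, h]
      rw [run_succ, (h' x).2.2]
      exact Nat.lt_succ_self _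

lemma measurable_noiseSum : Measurable fun s : LGState n d => s.noiseSum I w :=
  (measurable_b.sub (measurable_A.mulVec_vec measurable_const)).add_const _

lemma measurable_potential : Measurable fun s : LGState n d => s.potential I w := by
  have h1 := (measurable_A (n := n) (d := d)).matrix_det'
  have h2 : Measurable fun s : LGState n d => s.noiseSum I w ⬝ᵥ (s.A⁻¹ *ᵥ s.noiseSum I w) :=
    measurable_noiseSum.dotProduct_vec (measurable_A.matrix_inv.mulVec_vec measurable_noiseSum)
  unfold potential
  fun_prop

lemma potential_congr {s' : LGState n d} (hA : s'.A = s.A) (hb : s'.b = s.b) :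
    s'.potential I w = s.potential I w := by
  simp only [potential, noiseSum, hA, hb]

/-- With `u = xᵀA⁻¹x` and `r = xᵀA⁻¹v`, the determinant contributes `(1 + u)^(-1/2)` and the
quadratic form a noise-free factor `exp(-r²/(2R²(1 + u)))`. Both are inverse to the bound for the
exponential moment of the remaining factor, so the constants cancel exactly. -/
lemma lintegral_potential_sample_le {Ω : Type*} [MeasurableSpace Ω] {μ : Measure Ω}
    [IsProbabilityMeasure μ] {X : Ω → ℝ} (hX : Measurable X) (hR : I.R ≠ 0)
    (hsub : HasSubgaussianMGF X (I.R ^ 2) μ) (hA : s.A.PosDef) (q : ℕ × Fin n) :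
    ∫⁻ ω, (s.sample I w (fun _ => X ω) q).potential I w ∂μ ≤ s.potential I w := by
  set x := I.feature s.picks q.1 q.2 with hx
  set v := s.noiseSum I w with hv
  set u := x ⬝ᵥ (s.A⁻¹ *ᵥ x) with hu
  set r := x ⬝ᵥ (s.A⁻¹ *ᵥ v) with hr
  have hu0 : 0 ≤ u := dotProduct_mulVec_nonneg hA.inv.posSemidef x
  have h1u : 0 < 1 + u := by positivity
  have hR' : (0 : ℝ) < I.R := by positivity
  have hdet := hA.det_pos
  set K := √(I.lam ^ d / s.A.det) * (√(1 + u))⁻¹ * Real.exp (v ⬝ᵥ (s.A⁻¹ *ᵥ v) / (2 * I.R ^ 2))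
    * Real.exp (-(r ^ 2 / (2 * I.R ^ 2 * (1 + u)))) with hK
  have hK0 : 0 ≤ K := by positivity
  have hpt : ∀ ω, (s.sample I w (fun _ => X ω) q).potential I w = ENNReal.ofReal K *
      ENNReal.ofReal (Real.exp ((2 * X ω * r + X ω ^ 2 * u) / (2 * I.R ^ 2 * (1 + u)))) := by
    intro ω
    rw [← ENNReal.ofReal_mul hK0, potential, noiseSum_sample]
    congr 1
    have hAs : (s.sample I w (fun _ => X ω) q).A = s.A + vecMulVec x x := rfl
    rw [hAs, det_add_vecMulVec_self hA, dotProduct_inv_mulVec_update hA, ← hu, ← hr, hK,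
      ← div_div, Real.sqrt_div' _ h1u.le, div_eq_mul_inv (√(I.lam ^ d / s.A.det)), mul_assoc,
      mul_assoc, mul_assoc, mul_assoc, ← Real.exp_add, ← Real.exp_add, mul_assoc]
    congr 3
    field_simp
    ring
  simp_rw [hpt]
  rw [lintegral_const_mul _ (by fun_prop)]
  refine (mul_le_mul_right (lintegral_exp_quadratic_le hX hR hsub hu0 r) _).trans (le_of_eq ?_)
  rw [← ENNReal.ofReal_mul hK0, potential, hK]
  congr 1
  have h1 : Real.exp (-(r ^ 2 / (2 * I.R ^ 2 * (1 + u))))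
      * Real.exp (r ^ 2 / (2 * I.R ^ 2 * (1 + u))) = 1 := by
    rw [← Real.exp_add, neg_add_cancel, Real.exp_zero]
  have h2 : (√(1 + u))⁻¹ * √(1 + u) = 1 := inv_mul_cancel₀ (by positivity)
  calc _ = √(I.lam ^ d / s.A.det) * Real.exp (v ⬝ᵥ (s.A⁻¹ *ᵥ v) / (2 * I.R ^ 2))
      * ((√(1 + u))⁻¹ * √(1 + u)) * (Real.exp (-(r ^ 2 / (2 * I.R ^ 2 * (1 + u))))
      * Real.exp (r ^ 2 / (2 * I.R ^ 2 * (1 + u)))) := by ring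
    _ = _ := by rw [h1, h2, mul_one, mul_one]

lemma lintegral_potential_step_le {Ω : Type*} [MeasurableSpace Ω] {μ : Measure Ω}
    [IsProbabilityMeasure μ] {X : Ω → ℝ} (hX : Measurable X) (hR : I.R ≠ 0)
    (hsub : HasSubgaussianMGF X (I.R ^ 2) μ) (hA : s.A.PosDef) :
    ∫⁻ ω, (step I w (fun _ => X ω) s).potential I w ∂μ ≤ s.potential I w := by
  rcases step_cases I w s with ⟨s', h1, h2, -, h⟩ | ⟨q, h⟩
  · simp only [h, potential_congr h1 h2, lintegral_const, measure_univ, mul_one, le_refl]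
  · have : ∀ ω, (step I w (fun _ => X ω) s).potential I w
        = (s.sample I w (fun _ => X ω) q).potential I w := fun ω =>
      potential_congr (h _).1 (h _).2.1
    simp only [this]
    exact lintegral_potential_sample_le hX hR hsub hA q

/-- The sequence with the entries from the index `m` on set to zero. -/
noncomputable def truncate (m : ℕ) (x : ℕ → ℝ) : ℕ → ℝ := fun i => if i < m then x i else 0

/-- The truncated sequence is a function of the entries before `m` alone. It serves as the history
of a run that has taken `m` samples. -/
lemma indepFun_truncate {Ω : Type*} [MeasurableSpace Ω] {μ : Measure Ω} {ξ : ℕ → Ω → ℝ}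
    (hξ_meas : ∀ t, Measurable (ξ t)) (hξ_indep : iIndepFun ξ μ) (m : ℕ) :
    IndepFun (fun ω => truncate m fun t => ξ t ω) (ξ m) μ := by
  have h := hξ_indep.indepFun_finset (Finset.range m) {m} (by simp) hξ_meas
  have hφ : Measurable fun y : Finset.range m → ℝ =>
      (fun i => if hi : i < m then y ⟨i, Finset.mem_range.mpr hi⟩ else 0 : ℕ → ℝ) := by
    refine measurable_pi_lambda _ fun i => ?_
    by_cases hi : i < m
    · simp only [dif_pos hi]
      exact measurable_pi_apply _
    · simp only [dif_neg hi]
      exact measurable_const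
  have hψ : Measurable fun y : ({m} : Finset ℕ) → ℝ => y ⟨m, Finset.mem_singleton_self m⟩ :=
    measurable_pi_apply _
  have := h.comp hφ hψ
  convert this using 1
  · funext ω i
    simp [truncate]
  · rfl

variable {Ω : Type*} [MeasurableSpace Ω] {μ : Measure Ω} [IsProbabilityMeasure μ]
  {ξ : ℕ → Ω → ℝ}

/-- The potential is a supermartingale, restricted to the runs that have stayed in `S`. -/
lemma setLIntegral_potential_succ_le (hI : I.IsAdmissible) (hn : 0 < n) (hε : 0 < I.ε)
    (hlam : 0 < I.lam) (hR : I.R ≠ 0)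
    (hξ_meas : ∀ t, Measurable (ξ t)) (hξ_indep : iIndepFun ξ μ)
    (hξ_sub : ∀ t, HasSubgaussianMGF (ξ t) (I.R ^ 2) μ) {S : Set (LGState n d)}
    (hS : MeasurableSet S) (k : ℕ) :
    ∫⁻ ω in {ω | ∀ j ≤ k, run I w (fun t => ξ t ω) j ∈ S},
        (run I w (fun t => ξ t ω) (k + 1)).potential I w ∂μ
      ≤ ∫⁻ ω in {ω | ∀ j ≤ k, run I w (fun t => ξ t ω) j ∈ S},
        (run I w (fun t => ξ t ω) k).potential I w ∂μ := by
  have hξ : Measurable fun ω => fun t => ξ t ω := measurable_pi_lambda _ hξ_meas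
  -- The number of samples after `k` steps is random, as some steps take none. Splitting by its
  -- value `m` fixes the noise variable that the next step may read.
  set E : ℕ → Set (ℕ → ℝ) := fun m =>
    {x | (∀ j ≤ k, run I w x j ∈ S) ∧ (run I w x k).pulls.length = m} with hE
  have hEm : ∀ m, MeasurableSet (E m) := fun m => by
    have : E m = (⋂ j, ⋂ (_ : j ≤ k), (fun x => run I w x j) ⁻¹' S)
        ∩ (fun x => (run I w x k).pulls.length) ⁻¹' {m} := by
      ext x
      simp [hE]
    rw [this]
    exact (MeasurableSet.iInter fun j => MeasurableSet.iInter fun _ =>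
      measurable_run I w j hS).inter
      ((measurable_length_pulls.comp (measurable_run I w k)) (measurableSet_singleton m))
  have hunion : {ω | ∀ j ≤ k, run I w (fun t => ξ t ω) j ∈ S}
      = ⋃ m, (fun ω => fun t => ξ t ω) ⁻¹' E m := by
    ext ω
    simp [hE]
  have hdisj : Pairwise fun m m' => Disjoint ((fun ω => fun t => ξ t ω) ⁻¹' E m)
      ((fun ω => fun t => ξ t ω) ⁻¹' E m') := fun m m' hmm' =>
    Set.disjoint_left.mpr fun ω h h' => hmm' (h.2.symm.trans h'.2)
  rw [hunion, lintegral_iUnion (fun m => hξ (hEm m)) hdisj,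
    lintegral_iUnion (fun m => hξ (hEm m)) hdisj]
  refine ENNReal.tsum_le_tsum fun m => ?_
  have htr : ∀ x, (run I w x k).pulls.length = m → ∀ j ≤ k,
      run I w (truncate m x) j = run I w x j := fun x hx j hj =>
    run_congr fun i hi => by
      have := monotone_length_pulls (I := I) (w := w) x hj
      simp only at this
      rw [truncate, if_pos (by omega)]
  have htr' : ∀ x, (run I w (truncate m x) k).pulls.length = m → ∀ j ≤ k,
      run I w x j = run I w (truncate m x) j := fun x hx j hj =>
    run_congr fun i hi => by
      have := monotone_length_pulls (I := I) (w := w) (truncate m x) hj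
      simp only at this
      rw [truncate, if_pos (by omega)]
  -- Both the event and the run on it are determined by the first `m` entries, hence are independent
  -- of `ξ m`.
  have hmem : ∀ x, x ∈ E m ↔ truncate m x ∈ E m := fun x => by
    constructor
    · rintro ⟨h1, h2⟩
      exact ⟨fun j hj => by rw [htr x h2 j hj]; exact h1 j hj, by rw [htr x h2 k le_rfl, h2]⟩
    · rintro ⟨h1, h2⟩
      exact ⟨fun j hj => by rw [htr' x h2 j hj]; exact h1 j hj, by rw [htr' x h2 k le_rfl, h2]⟩
  have hind := indepFun_truncate hξ_meas hξ_indep m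
  have htm : Measurable fun ω => truncate m fun t => ξ t ω := by
    refine measurable_pi_lambda _ fun i => ?_
    unfold truncate
    split_ifs
    · exact hξ_meas i
    · exact measurable_const
  set g : (ℕ → ℝ) × ℝ → ℝ≥0∞ := fun p => (E m).indicator
    (fun _ => (step I w (fun _ => p.2) (run I w p.1 k)).potential I w) p.1 with hg
  have hgm : Measurable g := by
    have h1 : Measurable fun p : (ℕ → ℝ) × ℝ =>
        (step I w (fun _ => p.2) (run I w p.1 k)).potential I w :=
      measurable_potential.comp ((measurable_step I w).comp
        (((measurable_run I w k).comp measurable_fst).prodMk measurable_snd))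
    have h2 : g = (Prod.fst ⁻¹' E m).indicator fun p : (ℕ → ℝ) × ℝ =>
        (step I w (fun _ => p.2) (run I w p.1 k)).potential I w := by
      funext p
      rfl
    rw [h2]
    exact h1.indicator (measurable_fst (hEm m))
  -- By independence the joint law of history and next noise is a product, so the noise is
  -- integrated first, with the state held fixed.
  calc ∫⁻ ω in (fun ω => fun t => ξ t ω) ⁻¹' E m,
        (run I w (fun t => ξ t ω) (k + 1)).potential I w ∂μ
      = ∫⁻ ω, g (truncate m fun t => ξ t ω, ξ m ω) ∂μ := by
        rw [← lintegral_indicator (hξ (hEm m))]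
        refine lintegral_congr fun ω => ?_
        by_cases h : (fun t => ξ t ω) ∈ E m
        · rw [Set.indicator_of_mem (show ω ∈ (fun ω => fun t => ξ t ω) ⁻¹' E m from h)]
          simp only [hg]
          rw [Set.indicator_of_mem ((hmem _).mp h), htr _ h.2 k le_rfl, run_succ,
            step_eq_step_const, h.2]
        · rw [Set.indicator_of_notMem (show ω ∉ (fun ω => fun t => ξ t ω) ⁻¹' E m from h)]
          simp only [hg]
          rw [Set.indicator_of_notMem (fun h' => h ((hmem _).mpr h'))]
    _ = ∫⁻ p, g p ∂((μ.map fun ω => truncate m fun t => ξ t ω).prod (μ.map (ξ m))) := by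
        rw [← (indepFun_iff_map_prod_eq_prod_map_map htm.aemeasurable
          (hξ_meas m).aemeasurable).mp hind, lintegral_map hgm (htm.prodMk (hξ_meas m))]
    _ = ∫⁻ x, ∫⁻ z, g (x, z) ∂(μ.map (ξ m)) ∂(μ.map fun ω => truncate m fun t => ξ t ω) :=
        lintegral_prod _ hgm.aemeasurable
    _ ≤ ∫⁻ x, (E m).indicator (fun x => (run I w x k).potential I w) x
          ∂(μ.map fun ω => truncate m fun t => ξ t ω) := by
        refine lintegral_mono fun x => ?_
        by_cases h : x ∈ E m
        · simp only [hg, Set.indicator_of_mem h]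
          rw [lintegral_map _ (hξ_meas m)]
          · exact lintegral_potential_step_le (hξ_meas m) hR (hξ_sub m)
              ((wellFormed_run hI hn hε k).posDef hlam)
          · exact measurable_potential.comp ((measurable_step I w).comp
              (measurable_const.prodMk measurable_id))
        · simp only [hg, Set.indicator_of_notMem h, lintegral_zero, le_refl]
    _ = ∫⁻ ω in (fun ω => fun t => ξ t ω) ⁻¹' E m,
          (run I w (fun t => ξ t ω) k).potential I w ∂μ := by
        have hm : Measurable fun x => (run I w x k).potential I w :=
          measurable_potential.comp (measurable_run I w k)
        rw [lintegral_map (hm.indicator (hEm m)) htm, ← lintegral_indicator (hξ (hEm m))]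
        refine lintegral_congr fun ω => ?_
        by_cases h : (fun t => ξ t ω) ∈ E m
        · rw [Set.indicator_of_mem ((hmem _).mp h),
            Set.indicator_of_mem (show ω ∈ (fun ω => fun t => ξ t ω) ⁻¹' E m from h),
            htr _ h.2 k le_rfl]
        · rw [Set.indicator_of_notMem (fun h' => h ((hmem _).mpr h')),
            Set.indicator_of_notMem (show ω ∉ (fun ω => fun t => ξ t ω) ⁻¹' E m from h)]

/-- The confidence ellipsoid contains the weight vector if the noise is small in the norm of the
inverse design matrix. -/
lemma confident_of_matNorm_noiseSum_le (hs : s.WellFormed I) (hδ : 0 < I.δ) (hlam : 0 < I.lam)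
    (hw : l2norm w ≤ I.W)
    (h : matNorm s.A⁻¹ (s.noiseSum I w)
      ≤ I.R * √(2 * Real.log (1 / I.δ) + (Real.log s.A.det - d * Real.log I.lam))) :
    s.Confident I w := by
  intro x
  have hA := hs.posDef hlam
  have hinv := hA.inv.posSemidef
  -- The error of the estimate splits into a noise part and the bias of the regulariser.
  have e : s.what - w = s.A⁻¹ *ᵥ (s.noiseSum I w) - I.lam • (s.A⁻¹ *ᵥ w) := by
    rw [noiseSum, mulVec_add, mulVec_sub, mulVec_smul, inv_mulVec_cancel hA, what]
    abel
  have h1 := abs_dotProduct_mulVec_le hinv x (s.noiseSum I w)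
  have h2 := abs_dotProduct_mulVec_le hinv x w
  -- As `A` dominates `λ`, its inverse is at most `1/λ`, so the bias is the second summand of `C_t`.
  have h3 : I.lam * matNorm s.A⁻¹ w ≤ √I.lam * I.W := by
    have h4 := dotProduct_inv_mulVec_le hA hlam (fun z => by
      rw [hs.dotProduct_A]
      have : 0 ≤ ∑ q ∈ s.arms, (s.T q.1 q.2 : ℝ) * (I.feature s.picks q.1 q.2 ⬝ᵥ z) ^ 2 :=
        Finset.sum_nonneg fun q _ => mul_nonneg (Nat.cast_nonneg _) (sq_nonneg _)
      linarith) w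
    have h5 : l2norm w = √(w ⬝ᵥ w) := by
      rw [l2norm]
      congr 1
      exact Finset.sum_congr rfl fun i _ => sq (w i)
    have h6 : √I.lam * matNorm s.A⁻¹ w ≤ I.W := by
      rw [matNorm, ← Real.sqrt_mul hlam.le]
      exact (Real.sqrt_le_sqrt h4).trans (h5 ▸ hw)
    calc I.lam * matNorm s.A⁻¹ w = √I.lam * (√I.lam * matNorm s.A⁻¹ w) := by
          rw [← mul_assoc, Real.mul_self_sqrt hlam.le]
      _ ≤ _ := mul_le_mul_of_nonneg_left h6 (Real.sqrt_nonneg _)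
  rw [e, dotProduct_sub, dotProduct_smul, smul_eq_mul, C_eq hs hδ hlam]
  have hx := matNorm_nonneg s.A⁻¹ x
  calc _ ≤ |x ⬝ᵥ (s.A⁻¹ *ᵥ s.noiseSum I w)| + |I.lam * (x ⬝ᵥ (s.A⁻¹ *ᵥ w))| := abs_sub _ _
    _ ≤ matNorm s.A⁻¹ x * matNorm s.A⁻¹ (s.noiseSum I w)
        + I.lam * (matNorm s.A⁻¹ x * matNorm s.A⁻¹ w) := by
        rw [abs_mul, abs_of_pos hlam]
        gcongr
    _ = (matNorm s.A⁻¹ (s.noiseSum I w) + I.lam * matNorm s.A⁻¹ w) * matNorm s.A⁻¹ x := by ring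
    _ ≤ _ := by gcongr

/-- Taking logarithms turns the level `1/δ` into the radius of the ellipsoid; the determinant factor
of the potential becomes the log-determinant term. -/
lemma matNorm_noiseSum_le_of_potential_le (hs : s.WellFormed I) (hδ : 0 < I.δ)
    (hlam : 0 < I.lam) (hR : I.R ≠ 0) (h : s.potential I w ≤ ENNReal.ofReal (1 / I.δ)) :
    matNorm s.A⁻¹ (s.noiseSum I w)
      ≤ I.R * √(2 * Real.log (1 / I.δ) + (Real.log s.A.det - d * Real.log I.lam)) := by
  have hA := hs.posDef hlam
  have hdet := hA.det_pos
  have hR' : (0 : ℝ) < I.R := by positivity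
  rw [potential, ENNReal.ofReal_le_ofReal_iff (by positivity)] at h
  have h1 := Real.log_le_log (by positivity) h
  rw [Real.log_mul (by positivity) (by positivity), Real.log_exp, Real.log_sqrt (by positivity),
    Real.log_div (by positivity) (by positivity), Real.log_pow] at h1
  have e : (I.R : ℝ) * √(2 * Real.log (1 / I.δ) + (Real.log s.A.det - d * Real.log I.lam))
      = √(I.R ^ 2 * (2 * Real.log (1 / I.δ) + (Real.log s.A.det - d * Real.log I.lam))) := by
    rw [Real.sqrt_mul (sq_nonneg _), Real.sqrt_sq hR'.le]
  rw [e, matNorm]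
  refine Real.sqrt_le_sqrt ?_
  set Q := s.noiseSum I w ⬝ᵥ (s.A⁻¹ *ᵥ s.noiseSum I w)
  have h2 : Q / (2 * I.R ^ 2) ≤ Real.log (1 / I.δ)
      + (Real.log s.A.det - d * Real.log I.lam) / 2 := by linarith
  rw [div_le_iff₀ (by positivity)] at h2
  linarith

/-- With high probability the confidence ellipsoids of all steps contain the weight vector. -/
theorem le_measureReal_forall_confident (hI : I.IsAdmissible) (hn : 0 < n) (hε : 0 < I.ε)
    (hδ : 0 < I.δ) (hlam : 0 < I.lam) (hw : l2norm w ≤ I.W)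
    (hξ_meas : ∀ t, Measurable (ξ t)) (hξ_indep : iIndepFun ξ μ)
    (hξ_sub : ∀ t, HasSubgaussianMGF (ξ t) (I.R ^ 2) μ) :
    1 - I.δ ≤ μ.real {ω | ∀ k, (run I w (fun t => ξ t ω) k).Confident I w} := by
  have hwf : ∀ x k, (run I w x k).WellFormed I := fun x k => wellFormed_run hI hn hε k
  have hξ : Measurable fun ω => fun t => ξ t ω := measurable_pi_lambda _ hξ_meas
  -- The potential divides by `R²`. For `R = 0` the noise vanishes almost surely, so its weighted
  -- sum is zero throughout.
  by_cases hR : I.R = 0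
  · have h0 : ∀ᵐ ω ∂μ, ∀ t, ξ t ω = 0 := ae_all_iff.mpr fun t => by
      have h := hξ_sub t
      rw [hR] at h
      exact HasSubgaussianMGF.ae_eq_zero_of_hasSubgaussianMGF_zero (by simpa using h)
    have h1 : ∀ᵐ ω ∂μ, ∀ k, (run I w (fun t => ξ t ω) k).Confident I w := by
      filter_upwards [h0] with ω hω k
      have hz : (run I w (fun t => ξ t ω) k).noiseSum I w = 0 := by
        induction k with
        | zero => simp [noiseSum, run, start, smul_mulVec]
        | succ k ih =>
          rw [run_succ]
          rcases step_cases I w (run I w (fun t => ξ t ω) k) with ⟨s', hA, hb, -, h⟩ | ⟨q, h⟩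
          · rw [h, noiseSum, hA, hb]
            exact ih
          · rw [noiseSum, (h _).1, (h _).2.1, ← noiseSum, noiseSum_sample, ih, hω]
            simp
      refine confident_of_matNorm_noiseSum_le (hwf _ k) hδ hlam hw ?_
      rw [hz, hR]
      simp [matNorm]
    have h2 : μ {ω | ∀ k, (run I w (fun t => ξ t ω) k).Confident I w} = 1 :=
      (measure_congr (Filter.eventuallyEq_univ.mpr h1)).trans measure_univ
    rw [measureReal_def, h2]
    simp only [ENNReal.toReal_one]
    linarith
  · set f : ℕ → Ω → ℝ≥0∞ := fun k ω => (run I w (fun t => ξ t ω) k).potential I w with hf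
    set c := ENNReal.ofReal (1 / I.δ) with hc
    have hfm : ∀ k, Measurable (f k) := fun k =>
      measurable_potential.comp ((measurable_run I w k).comp hξ)
    have hville := mul_measure_exists_lt_le (μ := μ) hfm (c := c) (by
      have : ∀ ω, f 0 ω = 1 := fun ω => by
        simp only [hf, run, Function.iterate_zero, id_eq, potential, noiseSum, start]
        have : (0 : Fin d → ℝ) - (I.lam • (1 : Matrix (Fin d) (Fin d) ℝ)) *ᵥ w + I.lam • w = 0 := by
          simp [smul_mulVec]
        rw [this, det_smul, det_one, mul_one, Fintype.card_fin, div_self (by positivity)]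
        simp
      simp [this])
      (fun k => setLIntegral_potential_succ_le hI hn hε hlam hR hξ_meas hξ_indep hξ_sub
        (S := {s | s.potential I w ≤ c}) (measurableSet_le measurable_potential measurable_const)
        k)
    have hbad : μ {ω | ∃ k, c < f k ω} ≤ ENNReal.ofReal I.δ := by
      have h1 : ENNReal.ofReal I.δ * c = 1 := by
        rw [hc, ← ENNReal.ofReal_mul hδ.le, mul_one_div_cancel hδ.ne', ENNReal.ofReal_one]
      calc μ {ω | ∃ k, c < f k ω} = ENNReal.ofReal I.δ * (c * μ {ω | ∃ k, c < f k ω}) := by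
            rw [← mul_assoc, h1, one_mul]
        _ ≤ ENNReal.ofReal I.δ * 1 := by gcongr
        _ = _ := mul_one _
    have hbm : MeasurableSet {ω | ∃ k, c < f k ω} := by
      simp only [Set.ofPred_exists]
      exact MeasurableSet.iUnion fun k => measurableSet_lt measurable_const (hfm k)
    have h1 : 1 - I.δ ≤ μ.real {ω | ∃ k, c < f k ω}ᶜ := by
      rw [probReal_compl_eq_one_sub hbm]
      have := ENNReal.toReal_le_of_le_ofReal hδ.le hbad
      rw [measureReal_def]
      linarith
    refine h1.trans (measureReal_mono fun ω hω k => ?_)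
    have : f k ω ≤ c := by
      by_contra hcon
      exact hω ⟨k, not_le.mp hcon⟩
    exact confident_of_matNorm_noiseSum_le (hwf _ k) hδ hlam hw
      (matNorm_noiseSum_le_of_potential_le (hwf _ k) hδ hlam hR this)

end LGState

end SelfNormalised

/-! ### Submodularity and the greedy algorithm -/

section Greedy

variable {n d : ℕ} {F : Fin d → Finset (Fin n) → ℝ} {w : Fin d → ℝ}

lemma marginal_dotProduct (X : Finset (Fin n)) (a : Fin n) :
    marginal F X a ⬝ᵥ w = objective F w (insert a X) - objective F w X := by
  simp only [marginal, dotProduct, objective, ← Finset.sum_sub_distrib]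
  exact Finset.sum_congr rfl fun i _ => by ring

lemma objective_mono (hF : ∀ i, Monotone (F i)) (hw : ∀ i, 0 ≤ w i) : Monotone (objective F w) :=
  fun _ _ h => Finset.sum_le_sum fun i _ => mul_le_mul_of_nonneg_left (hF i h) (hw i)

lemma objective_nonneg (hF : ∀ i X, 0 ≤ F i X) (hw : ∀ i, 0 ≤ w i) (X : Finset (Fin n)) :
    0 ≤ objective F w X :=
  Finset.sum_nonneg fun i _ => mul_nonneg (hw i) (hF i X)

lemma isSubmodular_objective (hF : ∀ i, IsSubmodular (F i)) (hw : ∀ i, 0 ≤ w i) :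
    IsSubmodular (objective F w) := by
  intro X Y hXY x hx
  simp only [objective, ← Finset.sum_sub_distrib, ← mul_sub]
  exact Finset.sum_le_sum fun i _ => mul_le_mul_of_nonneg_left (hF i X Y hXY x hx) (hw i)

/-- The gain from adding a set is at most the sum of the marginal gains of its elements. -/
lemma IsSubmodular.union_sub_le {g : Finset (Fin n) → ℝ} (hg : IsSubmodular g)
    (X Y : Finset (Fin n)) : g (X ∪ Y) - g X ≤ ∑ a ∈ Y, (g (insert a X) - g X) := by
  induction Y using Finset.induction_on with
  | empty => simp
  | insert a Y ha ih =>
    rw [Finset.sum_insert ha, Finset.union_insert]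
    by_cases h : a ∈ X ∪ Y
    · have haX : a ∈ X := (Finset.mem_union.mp h).resolve_right ha
      rw [Finset.insert_eq_of_mem h, Finset.insert_eq_of_mem haX]
      linarith
    · have := hg X (X ∪ Y) Finset.subset_union_left a h
      linarith

/-- Coordinatewise, monotonicity makes the gain nonnegative, while diminishing returns and
nonnegativity at the empty set bound it by the value at the singleton. -/
lemma feature_dotProduct_self_le {I : LGInput n d} {L : ℝ} (hF_nonneg : ∀ i X, 0 ≤ I.F i X)
    (hF_mono : ∀ i, Monotone (I.F i)) (hF_sub : ∀ i, IsSubmodular (I.F i))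
    (hF_norm : ∀ a : Fin n, l2norm (fun i => I.F i {a}) ≤ L) (p : List (Fin n)) (l : ℕ)
    (a : Fin n) : I.feature p l a ⬝ᵥ I.feature p l a ≤ L ^ 2 := by
  have h1 : ∑ i, I.F i {a} ^ 2 ≤ L ^ 2 := by
    have h2 : 0 ≤ ∑ i, I.F i {a} ^ 2 := Finset.sum_nonneg fun i _ => sq_nonneg _
    rw [← Real.sq_sqrt h2]
    exact pow_le_pow_left₀ (Real.sqrt_nonneg _) (hF_norm a) 2
  refine le_trans (Finset.sum_le_sum fun i _ => ?_) h1
  rw [← sq]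
  have h0 : 0 ≤ I.feature p l a i :=
    sub_nonneg.mpr (hF_mono i (Finset.subset_insert a (p.take l).toFinset))
  refine pow_le_pow_left₀ h0 ?_ 2
  simp only [LGInput.feature, marginal]
  by_cases h : a ∈ (p.take l).toFinset
  · rw [Finset.insert_eq_of_mem h, sub_self]
    exact hF_nonneg i _
  · have h3 := hF_sub i ∅ _ (Finset.empty_subset _) a h
    have h4 := hF_nonneg i ∅
    rw [insert_empty_eq] at h3
    linarith

end Greedy

/-! ### Greedy progress and the succession of rounds -/

namespace LGState

variable {n d : ℕ} {I : LGInput n d} {w : Fin d → ℝ} {s : LGState n d}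

/-- The progress made in one round. -/
lemma sub_objective_nextRound_le (hI : I.IsAdmissible) (hn : 0 < n) (hκ : 0 < I.κ)
    (hε : 0 < I.ε)
    (hF_mono : ∀ i, Monotone (I.F i)) (hF_sub : ∀ i, IsSubmodular (I.F i))
    (hw : ∀ i, 0 ≤ w i) (hc : s.Confident I w) (hs : s.Stops I) {OPT : Finset (Fin n)}
    (hOPT : OPT.card ≤ I.κ) :
    objective I.F w OPT - objective I.F w (s.nextRound I).sol
      ≤ (1 - 1 / I.κ) * (objective I.F w OPT - objective I.F w s.sol) + I.ε / I.κ := by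
  have hκ' : (0 : ℝ) < I.κ := by exact_mod_cast hκ
  set i := s.iSel I with hi
  have hsol : (s.nextRound I).sol = insert i s.sol := by
    ext x
    simp [sol, nextRound, hi]
  set g := objective I.F w with hg
  have hgain : ∀ a, g (insert a s.sol) - g s.sol ≤ g (insert i s.sol) - g s.sol + I.ε / I.κ := by
    intro a
    have h1 := (hc.sub_le_ucb a).trans ((s.ucb_le_B I hI hn a).trans hs.2)
    rw [marginal_dotProduct, marginal_dotProduct] at h1
    linarith
  have hmono := objective_mono hF_mono hw
  -- Nonnegativity allows `OPT.card` to be replaced by the possibly larger `κ` in the next estimate.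
  have hi0 : 0 ≤ g (insert i s.sol) - g s.sol + I.ε / I.κ :=
    add_nonneg (sub_nonneg.mpr (hmono (Finset.subset_insert _ _))) (by positivity)
  have h2 : g OPT - g s.sol ≤ I.κ * (g (insert i s.sol) - g s.sol + I.ε / I.κ) := by
    calc g OPT - g s.sol ≤ g (s.sol ∪ OPT) - g s.sol :=
          sub_le_sub_right (hmono Finset.subset_union_right) _
      _ ≤ ∑ a ∈ OPT, (g (insert a s.sol) - g s.sol) :=
          (isSubmodular_objective hF_sub hw).union_sub_le _ _
      _ ≤ ∑ _a ∈ OPT, (g (insert i s.sol) - g s.sol + I.ε / I.κ) :=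
          Finset.sum_le_sum fun a _ => hgain a
      _ = OPT.card * (g (insert i s.sol) - g s.sol + I.ε / I.κ) := by
          rw [Finset.sum_const, nsmul_eq_mul]
      _ ≤ _ := mul_le_mul_of_nonneg_right (by exact_mod_cast hOPT) hi0
  have h3 : (g OPT - g s.sol) / I.κ ≤ g (insert i s.sol) - g s.sol + I.ε / I.κ := by
    rw [div_le_iff₀ hκ']
    linarith
  rw [hsol]
  have h4 : (1 - 1 / (I.κ : ℝ)) * (g OPT - g s.sol)
      = (g OPT - g s.sol) - (g OPT - g s.sol) / I.κ := by
    field_simp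
  rw [h4]
  linarith

/-- When all confidence ellipsoids contain the weight vector, every round begins, ends, and
satisfies the sample bound. -/
lemma exists_round_end {noise : ℕ → ℝ} {L : ℝ} (hI : I.IsAdmissible) (hn : 0 < n)
    (hε : 0 < I.ε) (hδ : 0 < I.δ) (hδ' : I.δ < 1) (hlam : 0 < I.lam)
    (hL : ∀ p l a, I.feature p l a ⬝ᵥ I.feature p l a ≤ L ^ 2)
    (hc : ∀ k, (run I w noise k).Confident I w) {k : ℕ}
    (hlt : (run I w noise k).picks.length < I.κ) :
    ∃ k' ≥ k, (run I w noise k').picks = (run I w noise k).picks ∧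
      (run I w noise k').Stops I ∧
      (I.lam * I.W ^ 2 ≤ 2 * I.R ^ 2 * Real.log (1 / I.δ) →
        ((run I w noise k').pulls.length : ℝ) - (run I w noise k).pulls.length
          ≤ (run I w noise k).sampleBound I w L) := by
  have hwf : ∀ k, (run I w noise k).WellFormed I := wellFormed_run hI hn hε
  set s₀ := run I w noise k with hs₀
  -- Only the explicit bound needs the condition on `λ`; without it any admissible `G` shows that
  -- the round ends.
  by_cases hW : I.lam * I.W ^ 2 ≤ 2 * I.R ^ 2 * Real.log (1 / I.δ)
  · set G := 4 * I.R ^ 2 * (2 * Real.log (1 / I.δ) + d * Real.log (s₀.M I w L)) with hG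
    have hlog : 0 < Real.log (1 / I.δ) := Real.log_pos (by rw [lt_div_iff₀ hδ]; linarith)
    have hM : 0 ≤ Real.log (s₀.M I w L) := Real.log_nonneg (by
      have := s₀.Htot_nonneg (I := I) (w := w)
      rw [M]
      have h1 : 0 ≤ 16 * s₀.Htot I w * I.R ^ 2 * L ^ 2 / I.lam * Real.log (1 / I.δ)
        + 32 * s₀.Htot I w ^ 2 * I.R ^ 4 * L ^ 4 / I.lam ^ 2
        + 2 * ((s₀.Ntot : ℝ) + n * ((s₀.picks.length : ℝ) + 1)) * L ^ 2 / (I.lam * d) := by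
        positivity
      linarith)
    obtain ⟨k', hk', hp, hend, hT⟩ := exists_stops (G := G) hI hn hε hlam hc hs₀.symm hlt.ne
      (by positivity) fun k' h => C_sq_le_of_length_le (hwf k') hδ hδ' hlam hL hW h
    exact ⟨k', hk', hp, hend, fun _ => sub_length_le_sampleBound (hwf k') (hwf k) hp hG hT⟩
  · obtain ⟨G, hG, hCG⟩ := exists_bound hδ hδ' hlam hL
      (by positivity : (0 : ℝ) ≤ s₀.Ntot + n * ((s₀.picks.length : ℝ) + 1))
      (s₀.Htot_nonneg (I := I) (w := w))
    obtain ⟨k', hk', hp, hend, -⟩ := exists_stops (G := G) hI hn hε hlam hc hs₀.symm hlt.ne hG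
      fun k' h => hCG _ (hwf k') h
    exact ⟨k', hk', hp, hend, fun h => absurd h hW⟩

/-- The start of every round, and the value of the solution held there. -/
lemma exists_round_start {noise : ℕ → ℝ} {L : ℝ} (hI : I.IsAdmissible) (hn : 0 < n)
    (hε : 0 < I.ε) (hδ : 0 < I.δ) (hδ' : I.δ < 1) (hlam : 0 < I.lam)
    (hL : ∀ p l a, I.feature p l a ⬝ᵥ I.feature p l a ≤ L ^ 2)
    (hF_nonneg : ∀ i X, 0 ≤ I.F i X)
    (hF_mono : ∀ i, Monotone (I.F i)) (hF_sub : ∀ i, IsSubmodular (I.F i))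
    (hw : ∀ i, 0 ≤ w i)
    (hc : ∀ k, (run I w noise k).Confident I w) {OPT : Finset (Fin n)} (hOPT : OPT.card ≤ I.κ)
    {l : ℕ} (hl : l ≤ I.κ) :
    ∃ k, (run I w noise k).picks.length = l ∧ (run I w noise k).swept = 0 ∧
      objective I.F w OPT - objective I.F w (run I w noise k).sol
        ≤ (1 - 1 / I.κ) ^ l * objective I.F w OPT + l * (I.ε / I.κ) := by
  induction l with
  | zero =>
    refine ⟨0, rfl, rfl, ?_⟩
    have := objective_nonneg hF_nonneg hw (run I w noise 0).sol
    simp only [pow_zero, one_mul, Nat.cast_zero, zero_mul, add_zero]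
    linarith
  | succ l ih =>
    obtain ⟨k, hk, -, hval⟩ := ih (Nat.le_of_succ_le hl)
    have hκ : 0 < I.κ := by omega
    have hκ' : (1 : ℝ) ≤ I.κ := by exact_mod_cast hκ
    obtain ⟨k', -, hp, hend, -⟩ := exists_round_end hI hn hε hδ hδ' hlam hL hc
      (by rw [hk]; exact hl : (run I w noise k).picks.length < I.κ)
    have hnh : ¬ (run I w noise k').Halted I := by
      rw [Halted, hp, hk]
      omega
    have hstep : run I w noise (k' + 1) = (run I w noise k').nextRound I := by
      rw [run_succ, step_of_stop hnh hend]
    refine ⟨k' + 1, ?_, ?_, ?_⟩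
    · rw [hstep, nextRound, List.length_append, hp, hk, List.length_singleton]
    · rw [hstep, nextRound]
    · rw [hstep]
      refine (sub_objective_nextRound_le hI hn hκ hε hF_mono hF_sub hw (hc k') hend
        hOPT).trans ?_
      have hsol : (run I w noise k').sol = (run I w noise k).sol := by rw [sol, sol, hp]
      have h1 : (1 : ℝ) / I.κ ≤ 1 := (div_le_one (by linarith)).mpr hκ'
      have h2 : (0 : ℝ) ≤ 1 / I.κ := by positivity
      have h3 : 0 ≤ (l : ℝ) * (I.ε / I.κ) := by positivity
      rw [hsol]
      have h4 := mul_le_mul_of_nonneg_left hval (sub_nonneg.mpr h1)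
      push_cast
      rw [pow_succ]
      -- The contraction also shrinks the accumulated error by `(1/κ) · l (ε/κ)`, and this gain is
      -- discarded.
      nlinarith [mul_nonneg h2 h3]

end LGState

/-! ### The main theorem -/

theorem theorem1 {n d : ℕ} (hn : 0 < n) (I : LGInput n d) (hI : I.IsAdmissible)
    (w : Fin d → ℝ) (L : ℝ) (OPT : Finset (Fin n))
    {Ω : Type*} [MeasurableSpace Ω] (μ : Measure Ω) [IsProbabilityMeasure μ] (ξ : ℕ → Ω → ℝ)
    -- the basis functions are nonnegative, monotone and submodular, the weights nonnegative
    (hF_nonneg : ∀ i X, 0 ≤ I.F i X)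
    (hF_mono : ∀ i, Monotone (I.F i))
    (hF_sub : ∀ i, IsSubmodular (I.F i))
    (hw_nonneg : ∀ i, 0 ≤ w i)
    -- the norm bounds
    (hw_norm : l2norm w ≤ I.W)
    (hF_norm : ∀ a : Fin n, l2norm (fun i => I.F i {a}) ≤ L)
    -- the parameters
    (hε : 0 < I.ε) (hδ : 0 < I.δ) (hδ' : I.δ < 1) (hlam : 0 < I.lam)
    -- the noise is i.i.d. and `R`-sub-Gaussian (in particular centred)
    (hξ_meas : ∀ t, Measurable (ξ t))
    (hξ_indep : iIndepFun ξ μ)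
    (hξ_ident : ∀ t, IdentDistrib (ξ t) (ξ 0) μ μ)
    (hξ_sub : ∀ t, HasSubgaussianMGF (ξ t) (I.R ^ 2) μ)
    -- an optimal solution
    (hOPT_card : OPT.card ≤ I.κ)
    (hOPT : ∀ X : Finset (Fin n), X.card ≤ I.κ → objective I.F w X ≤ objective I.F w OPT) :
    1 - I.δ ≤ μ.real {ω |
      -- the algorithm returns a set of almost optimal value
      (∃ k, (LGState.run I w (fun t => ξ t ω) k).Halted I ∧
        (1 - Real.exp (-1)) * objective I.F w OPT - I.ε
          ≤ objective I.F w (LGState.run I w (fun t => ξ t ω) k).sol) ∧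
      -- every round begins at some step `k` and meets its stopping condition at some step `k'`,
      -- and between the two not too many samples are taken
      (∀ l < I.κ, ∃ k k', k ≤ k' ∧
        (LGState.run I w (fun t => ξ t ω) k).picks.length = l ∧
        (LGState.run I w (fun t => ξ t ω) k).swept = 0 ∧
        (LGState.run I w (fun t => ξ t ω) k').picks.length = l ∧
        (LGState.run I w (fun t => ξ t ω) k').Stops I ∧
        (I.lam * I.W ^ 2 ≤ 2 * I.R ^ 2 * Real.log (1 / I.δ) →
          ((LGState.run I w (fun t => ξ t ω) k').pulls.length : ℝ)
              - (LGState.run I w (fun t => ξ t ω) k).pulls.length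
            ≤ (LGState.run I w (fun t => ξ t ω) k).sampleBound I w L))} := by
  have hL := feature_dotProduct_self_le hF_nonneg hF_mono hF_sub hF_norm
  refine (LGState.le_measureReal_forall_confident hI hn hε hδ hlam hw_norm hξ_meas hξ_indep
    hξ_sub).trans (measureReal_mono fun ω hc => ⟨?_, fun l hl => ?_⟩)
  · obtain ⟨k, hk, -, hval⟩ := LGState.exists_round_start hI hn hε hδ hδ' hlam hL hF_nonneg
      hF_mono hF_sub hw_nonneg hc hOPT_card le_rfl
    refine ⟨k, hk, ?_⟩
    have h0 := objective_nonneg hF_nonneg hw_nonneg OPT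
    -- For `κ = 0` the factor `(1 - 1/κ)^κ` is one, so the general estimate is too weak; but then
    -- `OPT` is empty and monotonicity suffices.
    rcases Nat.eq_zero_or_pos I.κ with hκ | hκ
    · have hO : OPT = ∅ := Finset.card_eq_zero.mp (by omega)
      have h1 := objective_mono hF_mono hw_nonneg
        (Finset.empty_subset (LGState.run I w (fun t => ξ t ω) k).sol)
      rw [hO] at h0 ⊢
      have h2 := mul_nonneg (Real.exp_pos (-1)).le h0
      linarith
    · have hκ' : (1 : ℝ) ≤ I.κ := by exact_mod_cast hκ
      have h1 : (1 - 1 / (I.κ : ℝ)) ^ I.κ ≤ Real.exp (-1) :=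
        Real.one_sub_div_pow_le_exp_neg hκ'
      have h2 := mul_le_mul_of_nonneg_right h1 h0
      have h3 : (I.κ : ℝ) * (I.ε / I.κ) = I.ε := by field_simp
      linarith
  · obtain ⟨k, hk, hsw, -⟩ := LGState.exists_round_start hI hn hε hδ hδ' hlam hL hF_nonneg
      hF_mono hF_sub hw_nonneg hc hOPT_card hl.le
    obtain ⟨k', hk', hp, hend, hb⟩ := LGState.exists_round_end hI hn hε hδ hδ' hlam hL hc
      (by rw [hk]; exact hl : (LGState.run I w (fun t => ξ t ω) k).picks.length < I.κ)
    exact ⟨k, k', hk', hk, hsw, by rw [hp, hk], hend, hb⟩
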